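/- Let $y = X\beta^* + \epsilon$ with a deterministic design $X\in\mathbb{R}^{n\times p}$ (rows $X_i$), let $\mathcal{G}_1,\dots,\mathcal{G}_g$ be a partition of $[p]$ into nonempty groups, and take the weights $w_l = |\mathcal{G}_l|^{1/2}$. Put $$L(u)=\frac{1}{n(n-1)}\sum_{i=1}^n\sum_{j\neq i}|u_i-u_j|,\qquad \Psi(\beta)=\sum_{l=1}^g w_l\|\beta_{\mathcal{G}_l}\|_2,\qquad \Psi^d(y)=\sup_{\Psi(x)\le 1}\langle x,y\rangle .$$ For $c_0>1$ and $0<\alpha_0<1$ let $\lambda^* = c_0\, Q(1-\alpha_0)$, where $Q(q)=\inf\{t: \Pr(\Psi^d(S_n)\le t)\ge q\}$ is the quantile function of $\Psi^d(S_n)$ with $S_n = -\frac{2}{n(n-1)}X^\top(2r-(n+1))$ and $r$ uniformly distributed over the permutations of $[n]$. Let $\Omega$ be the union of the groups that contain an index $j$ with $\beta^*_j\neq 0$, let $\mathcal{A}_0$ be the set of indices $l$ of these groups, let $\Psi_\Omega(\beta)$ and $\Psi_{\bar\Omega}(\beta)$ be the values of $\Psi$ at the coordinate projections of $\beta$ onto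 $\Omega$ and onto its complement, and put $$\bar c = 1+\frac{c_0+1}{c_0-1},\qquad c_{|\Omega|}=\sqrt{\sum_{l\in\mathcal{A}_0}w_l^2},\qquad c_p=\max_{l}w_l^{-1}\sqrt{|\mathcal{G}_l|},\qquad \mathcal{E}(n,p)=\frac{\log p}{n}+\sqrt{\frac{\log p}{n}} .$$ Assume, for constants $b_1,b_2,b_3>0$: (A-1) $\sum_i X_i=0$, $|X_{ij}|\le b_1$ for all $i,j$, and $\gamma^\top X^\top X\gamma \ge b_2\, n\|\gamma\|_2^2$ for every $\gamma$ with $\Psi_{\bar\Omega}(\gamma)\le(\bar c-1)\Psi_\Omega(\gamma)$; (A-2) $\epsilon_1,\dots,\epsilon_n$ are i.i.d. with a density, and the differences $\epsilon_i-\epsilon_j$ ($i\neq j$) have a density $f^*$ with $f^*(\zeta)\ge b_3$ for all $|\zeta|\le \frac{68 b_1^2c_0\bar c^2}{b_2b_3}\,c_p^2\,c_{|\Omega|}^2\,\mathcal{E}(n,p)$. If $e^n\ge p\ge 2/\alpha_0$ and $\lambda^*>0$, then the group lasso regularized rank regression problem $\min_\beta\{L(X\beta-y)+\lambda^*\Psi(\beta)\}$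 has a minimizer, and with probability at least $1-p^{-1}-\alpha_0$ every minimizer $\hat\beta(\lambda^*)$ satisfies $$\|\hat\beta(\lambda^*)-\beta^*\|_2\le \frac{68 b_1c_0\bar c}{b_2b_3}\sqrt{\frac{|\Omega|\log p}{n}} .$$ -/

import Mathlib

open MeasureTheory ProbabilityTheory Matrix
open scoped BigOperators

noncomputable section

namespace RankGroupLasso

/-- `G` is a partition of the coefficient indices into `g` (nonempty, disjoint) groups. -/
structure IsGrouping {p g : ℕ} (G : Fin g → Finset (Fin p)) : Prop where
  nonempty : ∀ l, (G l).Nonempty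
  disjoint : ∀ l m, l ≠ m → Disjoint (G l) (G m)
  cover : ∀ j, ∃ l, j ∈ G l

/-- The Euclidean norm of the subvector of `β` with indices in `I`. -/
def subNorm {p : ℕ} (I : Finset (Fin p)) (β : EuclideanSpace ℝ (Fin p)) : ℝ :=
  √(∑ j ∈ I, β j ^ 2)

/-- The group lasso regularizer `Ψ(β) = ∑ₗ wₗ ‖β_{Gₗ}‖₂`. -/
def groupPenalty {p g : ℕ} (G : Fin g → Finset (Fin p)) (w : Fin g → ℝ)
    (β : EuclideanSpace ℝ (Fin p)) : ℝ :=
  ∑ l, w l * subNorm (G l) β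

/-- The dual norm `Ψᵈ(y) = sup {⟨x, y⟩ : Ψ(x) ≤ 1}`. -/
def dualPenalty {p g : ℕ} (G : Fin g → Finset (Fin p)) (w : Fin g → ℝ)
    (y : EuclideanSpace ℝ (Fin p)) : ℝ :=
  sSup {t : ℝ | ∃ x : EuclideanSpace ℝ (Fin p), groupPenalty G w x ≤ 1 ∧ t = inner ℝ x y}

/-- The Wilcoxon rank loss `L(u) = (n(n-1))⁻¹ ∑ᵢ ∑_{j ≠ i} |uᵢ - uⱼ|`. -/
def rankLoss {n : ℕ} (u : Fin n → ℝ) : ℝ :=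
  1 / ((n : ℝ) * ((n : ℝ) - 1)) * ∑ i, ∑ j ∈ Finset.univ.erase i, |u i - u j|

/-- The objective `β ↦ L(Xβ - y) + lam Ψ(β)`. -/
def objective {n p g : ℕ} (X : Matrix (Fin n) (Fin p) ℝ) (y : Fin n → ℝ)
    (G : Fin g → Finset (Fin p)) (w : Fin g → ℝ) (lam : ℝ)
    (β : EuclideanSpace ℝ (Fin p)) : ℝ :=
  rankLoss (X *ᵥ β.ofLp - y) + lam * groupPenalty G w β

/-- `β` is a group lasso regularized rank regression estimator: a global minimizer of the
objective. -/
def IsEstimator {n p g : ℕ} (X : Matrix (Fin n) (Fin p) ℝ) (y : Fin n → ℝ)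
    (G : Fin g → Finset (Fin p)) (w : Fin g → ℝ) (lam : ℝ)
    (β : EuclideanSpace ℝ (Fin p)) : Prop :=
  IsMinOn (objective X y G w lam) Set.univ β

/-- `ξ = 2 r - (n + 1)` for the rank vector `r` with values in `{1, …, n}`; a permutation `r` of
`Fin n` takes values in `{0, …, n-1}`, whence the shift by one. -/
def rankScore {n : ℕ} (r : Equiv.Perm (Fin n)) (i : Fin n) : ℝ :=
  2 * (((r i : ℕ) : ℝ) + 1) - ((n : ℝ) + 1)

/-- `Sₙ = - 2 / (n(n-1)) Xᵀ ξ`, as a function of the rank vector. -/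
def rankGradient {n p : ℕ} (X : Matrix (Fin n) (Fin p) ℝ) (r : Equiv.Perm (Fin n)) :
    EuclideanSpace ℝ (Fin p) :=
  WithLp.toLp 2 ((-(2 / ((n : ℝ) * ((n : ℝ) - 1)))) • (Xᵀ *ᵥ rankScore r))

/-- The distribution function at `t` of `Ψᵈ(Sₙ)`, the rank vector being uniformly distributed over
all permutations. -/
def dualGradientCDF {n p g : ℕ} (X : Matrix (Fin n) (Fin p) ℝ) (G : Fin g → Finset (Fin p))
    (w : Fin g → ℝ) (t : ℝ) : ℝ :=
  (Nat.card {r : Equiv.Perm (Fin n) // dualPenalty G w (rankGradient X r) ≤ t} : ℝ)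
    / (Nat.card (Equiv.Perm (Fin n)) : ℝ)

/-- The simulation-based parameter `c₀ · Q(1 - α₀)`, with `Q(q) = inf {t : q ≤ CDF(t)}` the
quantile function of `Ψᵈ(Sₙ)`. -/
def lambdaStar {n p g : ℕ} (X : Matrix (Fin n) (Fin p) ℝ) (G : Fin g → Finset (Fin p))
    (w : Fin g → ℝ) (c₀ α₀ : ℝ) : ℝ :=
  c₀ * sInf {t : ℝ | 1 - α₀ ≤ dualGradientCDF X G w t}

open Classical in
/-- The indices of the active groups, i.e. those that meet the support of `β`. -/
def activeGroups {p g : ℕ} (G : Fin g → Finset (Fin p)) (β : EuclideanSpace ℝ (Fin p)) :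
    Finset (Fin g) :=
  Finset.univ.filter fun l => ∃ j ∈ G l, β j ≠ 0

/-- The group-expanded support: the union of the active groups. -/
def expandedSupport {p g : ℕ} (G : Fin g → Finset (Fin p)) (β : EuclideanSpace ℝ (Fin p)) :
    Finset (Fin p) :=
  (activeGroups G β).biUnion G

/-- The coordinate projection: agrees with `β` on `I` and vanishes elsewhere. -/
def proj {p : ℕ} (I : Finset (Fin p)) (β : EuclideanSpace ℝ (Fin p)) :
    EuclideanSpace ℝ (Fin p) :=
  WithLp.toLp 2 fun j => if j ∈ I then β j else 0

/-- `c_{|Ω|} = √(∑_{l active} wₗ²)`. -/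
def cSupport {p g : ℕ} (G : Fin g → Finset (Fin p)) (w : Fin g → ℝ)
    (βs : EuclideanSpace ℝ (Fin p)) : ℝ :=
  √(∑ l ∈ activeGroups G βs, w l ^ 2)

/-- `c_p = maxₗ wₗ⁻¹ √|Gₗ|`. -/
def cMax {p g : ℕ} (G : Fin g → Finset (Fin p)) (w : Fin g → ℝ) : ℝ :=
  ⨆ l, (w l)⁻¹ * √((G l).card : ℝ)

/-- `c̄ = 1 + (c₀ + 1) / (c₀ - 1)`. -/
def cBar (c₀ : ℝ) : ℝ := 1 + (c₀ + 1) / (c₀ - 1)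

/-- `𝓔(n, p) = n⁻¹ log p + √(n⁻¹ log p)`. -/
def rate (n p : ℕ) : ℝ :=
  (n : ℝ)⁻¹ * Real.log p + √((n : ℝ)⁻¹ * Real.log p)

/-- The design matrix condition: centered and bounded covariates, and the restricted eigenvalue
condition on the cone `Ψ_{Ωᶜ}(γ) ≤ (c̄ - 1) Ψ_Ω(γ)`, where `Ω` is the group-expanded support of
`βs`. -/
structure DesignCondition {n p g : ℕ} (X : Matrix (Fin n) (Fin p) ℝ)
    (G : Fin g → Finset (Fin p)) (w : Fin g → ℝ) (βs : EuclideanSpace ℝ (Fin p))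
    (c₀ b₁ b₂ : ℝ) : Prop where
  centered : ∀ j, ∑ i, X i j = 0
  bounded : ∀ i j, |X i j| ≤ b₁
  restricted_eigenvalue : ∀ γ : EuclideanSpace ℝ (Fin p), γ ≠ 0 →
    groupPenalty G w (proj (expandedSupport G βs)ᶜ γ)
      ≤ (cBar c₀ - 1) * groupPenalty G w (proj (expandedSupport G βs) γ) →
    b₂ ≤ (γ.ofLp ⬝ᵥ ((Xᵀ * X) *ᵥ γ.ofLp)) / ((n : ℝ) * ‖γ‖ ^ 2)

/-- The real random variable `Z` has the function `f` as a probability density. -/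
structure HasDensity {S : Type*} [MeasurableSpace S] (P : Measure S) (Z : S → ℝ) (f : ℝ → ℝ) :
    Prop where
  measurable : Measurable f
  nonneg : ∀ z, 0 ≤ f z
  law : P.map Z = volume.withDensity fun z => ENNReal.ofReal (f z)

/-- The error distribution condition: i.i.d. errors with a density, such that the differences
`εᵢ - εⱼ`, `i ≠ j`, have a density that is at least `b₃` on `[-R, R]`. -/
structure ErrorCondition {S : Type*} [MeasurableSpace S] (P : Measure S) {n : ℕ}
    (ε : Fin n → S → ℝ) (b₃ R : ℝ) : Prop where
  measurable : ∀ i, Measurable (ε i)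
  indep : iIndepFun ε P
  density : ∃ f : ℝ → ℝ, ∀ i, HasDensity P (ε i) f
  difference_density : ∃ fs : ℝ → ℝ,
    (∀ i j, i ≠ j → HasDensity P (fun s => ε i s - ε j s) fs) ∧ ∀ z, |z| ≤ R → b₃ ≤ fs z

end RankGroupLasso

end

/-! The rank loss is convex, and a subgradient of it at `βs` depends on the errors only through
their ranks. For i.i.d. errors, some compatible rank vector lies in a set `K` with probability at
least `|K| / n!` (`card_le_measure_compatibleErrors`), so `Ψᵈ(Sₙ) ≤ Q` holds with probability at
least `1 - α₀`. On that event `λ* ≥ c₀ Ψᵈ(Sₙ)`. The subgradient inequality, duality and the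
splitting of `Ψ` over active and inactive groups then put every perturbation `γ` that does not
increase the objective into the cone (`mem_cone`), where `Ψ(γ) ≤ c̄ √|Ω| ‖γ‖`.

By convexity it suffices to exclude perturbations in the cone of one fixed norm `r`, a multiple of
`√|Ω| x` with `x = √(log p / n)`. The expected loss grows there by at least `2 b₂ b₃ r²`
(`le_integral_shiftLoss`, `le_expectedLoss`, restricted eigenvalues). With probability at least `1 -
1/p`, the actual growth falls short of this bound by at most `17 b₁ c̄ √|Ω| r x`
(`exists_uniform_lower_bound`). The penalty gains at most `λ* √|Ω| r ≤ 8 b₁ c₀ x √|Ω| r`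
(`le_dualGradientCDF`). The choice of `r` makes the quadratic term win.

Both tail bounds use Hoeffding's device: a U-statistic is an average over permutations of averages
over disjoint pairs (`uStatistic_eq_average`), and convexity of `exp` carries moment bounds through
the average. For rank statistics the pair signs are independent Rademacher variables. For the loss
the pair differences are independent, and the supremum is treated one coordinate at a time: an
independent copy symmetrizes, contraction replaces loss increments by linear forms, and a linear
form on an `ℓ₁` ball is largest at a vertex (`integral_pi_supExp_le`). -/

namespace RankGroupLasso

/-! ### The group penalty, its splitting over `Ω` and its dual norm -/

section Norms

variable {p g : ℕ}

lemma subNorm_nonneg (I : Finset (Fin p)) (β : EuclideanSpace ℝ (Fin p)) : 0 ≤ subNorm I β :=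
  Real.sqrt_nonneg _

lemma subNorm_eq_norm_proj (I : Finset (Fin p)) (β : EuclideanSpace ℝ (Fin p)) :
    subNorm I β = ‖proj I β‖ := by
  rw [EuclideanSpace.norm_eq, subNorm]
  congr 1
  simp [proj, apply_ite, Finset.sum_ite_mem]

lemma proj_add (I : Finset (Fin p)) (a b : EuclideanSpace ℝ (Fin p)) :
    proj I (a + b) = proj I a + proj I b := by
  ext j
  by_cases h : j ∈ I <;> simp [proj, h]

lemma proj_smul (I : Finset (Fin p)) (c : ℝ) (b : EuclideanSpace ℝ (Fin p)) :
    proj I (c • b) = c • proj I b := by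
  ext j
  by_cases h : j ∈ I <;> simp [proj, h]

lemma subNorm_add_le (I : Finset (Fin p)) (a b : EuclideanSpace ℝ (Fin p)) :
    subNorm I (a + b) ≤ subNorm I a + subNorm I b := by
  simp only [subNorm_eq_norm_proj, proj_add]
  exact norm_add_le _ _

lemma subNorm_smul (I : Finset (Fin p)) (c : ℝ) (b : EuclideanSpace ℝ (Fin p)) :
    subNorm I (c • b) = |c| * subNorm I b := by
  simp only [subNorm_eq_norm_proj, proj_smul, norm_smul, Real.norm_eq_abs]

lemma subNorm_congr {I : Finset (Fin p)} {a b : EuclideanSpace ℝ (Fin p)}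
    (h : ∀ j ∈ I, a j = b j) : subNorm I a = subNorm I b := by
  unfold subNorm
  rw [Finset.sum_congr rfl fun j hj => by rw [h j hj]]

lemma subNorm_eq_zero {I : Finset (Fin p)} {a : EuclideanSpace ℝ (Fin p)}
    (h : ∀ j ∈ I, a j = 0) : subNorm I a = 0 := by
  unfold subNorm
  rw [Finset.sum_eq_zero fun j hj => by rw [h j hj]; norm_num, Real.sqrt_zero]

variable {G : Fin g → Finset (Fin p)} {w : Fin g → ℝ}

lemma groupPenalty_nonneg (hw : ∀ l, 0 ≤ w l) (a : EuclideanSpace ℝ (Fin p)) :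
    0 ≤ groupPenalty G w a :=
  Finset.sum_nonneg fun l _ => mul_nonneg (hw l) (subNorm_nonneg _ _)

lemma groupPenalty_add_le (hw : ∀ l, 0 ≤ w l) (a b : EuclideanSpace ℝ (Fin p)) :
    groupPenalty G w (a + b) ≤ groupPenalty G w a + groupPenalty G w b := by
  unfold groupPenalty
  rw [← Finset.sum_add_distrib]
  refine Finset.sum_le_sum fun l _ => ?_
  rw [← mul_add]
  exact mul_le_mul_of_nonneg_left (subNorm_add_le _ _ _) (hw l)

lemma groupPenalty_smul (c : ℝ) (b : EuclideanSpace ℝ (Fin p)) :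
    groupPenalty G w (c • b) = |c| * groupPenalty G w b := by
  simp only [groupPenalty, subNorm_smul, Finset.mul_sum]
  exact Finset.sum_congr rfl fun l _ => by ring

lemma continuous_groupPenalty : Continuous (groupPenalty G w) := by
  unfold groupPenalty subNorm
  fun_prop

lemma sum_eq_sum_groups (hG : IsGrouping G) (f : Fin p → ℝ) :
    ∑ j, f j = ∑ l, ∑ j ∈ G l, f j := by
  rw [← Finset.sum_biUnion fun l _ m _ h => hG.disjoint l m h]
  congr 1
  ext j
  simpa using hG.cover j

/-- Cauchy–Schwarz in each group costs exactly the weight `√|Gₗ|`. Cone membership thereby controls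
the `ℓ₁` norm, and the dual norm is at most the sup norm. -/
lemma l1_le_groupPenalty (hG : IsGrouping G) (hw : ∀ l, w l = √((G l).card : ℝ))
    (γ : EuclideanSpace ℝ (Fin p)) : ∑ j, |γ j| ≤ groupPenalty G w γ := by
  rw [sum_eq_sum_groups hG]
  refine Finset.sum_le_sum fun l _ => ?_
  rw [hw, subNorm, ← Real.sqrt_mul (by positivity)]
  refine Real.le_sqrt_of_sq_le ?_
  have := sq_sum_le_card_mul_sum_sq (s := G l) (f := fun j => |γ j|)
  simpa using this

lemma norm_le_l1 (γ : EuclideanSpace ℝ (Fin p)) : ‖γ‖ ≤ ∑ j, |γ j| := by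
  rw [EuclideanSpace.norm_eq]
  refine Real.sqrt_le_iff.2 ⟨by positivity, ?_⟩
  exact Finset.sum_sq_le_sq_sum_of_nonneg fun j _ => abs_nonneg _

lemma norm_le_groupPenalty (hG : IsGrouping G) (hw : ∀ l, w l = √((G l).card : ℝ))
    (γ : EuclideanSpace ℝ (Fin p)) : ‖γ‖ ≤ groupPenalty G w γ :=
  (norm_le_l1 γ).trans (l1_le_groupPenalty hG hw γ)

lemma mem_expandedSupport {βs : EuclideanSpace ℝ (Fin p)} {j : Fin p} :
    j ∈ expandedSupport G βs ↔ ∃ l ∈ activeGroups G βs, j ∈ G l := by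
  simp [expandedSupport]

lemma notMem_expandedSupport (hG : IsGrouping G) {βs : EuclideanSpace ℝ (Fin p)} {j : Fin p}
    {l : Fin g} (hl : l ∉ activeGroups G βs) (hj : j ∈ G l) : j ∉ expandedSupport G βs := by
  rw [mem_expandedSupport]
  rintro ⟨m, hm, hjm⟩
  have hne : l ≠ m := fun h => hl (h ▸ hm)
  exact Finset.disjoint_left.1 (hG.disjoint l m hne) hj hjm

lemma groupPenalty_proj (hG : IsGrouping G) (βs γ : EuclideanSpace ℝ (Fin p)) :
    groupPenalty G w (proj (expandedSupport G βs) γ)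
      = ∑ l ∈ activeGroups G βs, w l * subNorm (G l) γ := by
  unfold groupPenalty
  rw [← Finset.sum_subset (Finset.subset_univ (activeGroups G βs))]
  · refine Finset.sum_congr rfl fun l hl => ?_
    rw [subNorm_congr fun j hj => ?_]
    have : j ∈ expandedSupport G βs := mem_expandedSupport.2 ⟨l, hl, hj⟩
    simp [proj, this]
  · intro l _ hl
    rw [subNorm_eq_zero fun j hj => ?_, mul_zero]
    simp [proj, notMem_expandedSupport hG hl hj]

lemma groupPenalty_proj_compl (hG : IsGrouping G) (βs γ : EuclideanSpace ℝ (Fin p)) :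
    groupPenalty G w (proj (expandedSupport G βs)ᶜ γ)
      = ∑ l ∈ (activeGroups G βs)ᶜ, w l * subNorm (G l) γ := by
  unfold groupPenalty
  rw [← Finset.sum_subset (Finset.subset_univ (activeGroups G βs)ᶜ)]
  · refine Finset.sum_congr rfl fun l hl => ?_
    rw [subNorm_congr fun j hj => ?_]
    simp [proj, notMem_expandedSupport hG (Finset.mem_compl.1 hl) hj]
  · intro l _ hl
    rw [subNorm_eq_zero fun j hj => ?_, mul_zero]
    have : j ∈ expandedSupport G βs :=
      mem_expandedSupport.2 ⟨l, by simpa using hl, hj⟩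
    simp [proj, this]

lemma groupPenalty_eq_add (hG : IsGrouping G) (βs γ : EuclideanSpace ℝ (Fin p)) :
    groupPenalty G w γ = groupPenalty G w (proj (expandedSupport G βs) γ)
      + groupPenalty G w (proj (expandedSupport G βs)ᶜ γ) := by
  rw [groupPenalty_proj hG, groupPenalty_proj_compl hG, Finset.sum_add_sum_compl, groupPenalty]

lemma eq_zero_of_notMem_activeGroups {βs : EuclideanSpace ℝ (Fin p)} {l : Fin g}
    (hl : l ∉ activeGroups G βs) {j : Fin p} (hj : j ∈ G l) : βs j = 0 := by
  by_contra h
  exact hl (by simpa [activeGroups] using ⟨j, hj, h⟩)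

/-- The penalty decreases by at most the active part of the perturbation, and increases by its
inactive part. -/
lemma groupPenalty_sub_le (hG : IsGrouping G) (hw : ∀ l, 0 ≤ w l)
    (βs γ : EuclideanSpace ℝ (Fin p)) :
    groupPenalty G w βs - groupPenalty G w (βs + γ)
      ≤ groupPenalty G w (proj (expandedSupport G βs) γ)
        - groupPenalty G w (proj (expandedSupport G βs)ᶜ γ) := by
  rw [groupPenalty_eq_add hG βs βs, groupPenalty_eq_add hG βs (βs + γ)]
  simp only [groupPenalty_proj hG, groupPenalty_proj_compl hG]
  have h1 : ∑ l ∈ (activeGroups G βs)ᶜ, w l * subNorm (G l) βs = 0 :=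
    Finset.sum_eq_zero fun l hl => by
      rw [subNorm_eq_zero fun j hj => eq_zero_of_notMem_activeGroups (Finset.mem_compl.1 hl) hj,
        mul_zero]
  have h2 : ∑ l ∈ (activeGroups G βs)ᶜ, w l * subNorm (G l) (βs + γ)
      = ∑ l ∈ (activeGroups G βs)ᶜ, w l * subNorm (G l) γ :=
    Finset.sum_congr rfl fun l hl => by
      rw [subNorm_congr fun j hj => ?_]
      simp [eq_zero_of_notMem_activeGroups (Finset.mem_compl.1 hl) hj]
  have h3 : ∑ l ∈ activeGroups G βs, w l * subNorm (G l) βs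
      ≤ ∑ l ∈ activeGroups G βs, w l * subNorm (G l) (βs + γ)
        + ∑ l ∈ activeGroups G βs, w l * subNorm (G l) γ := by
    rw [← Finset.sum_add_distrib]
    refine Finset.sum_le_sum fun l _ => ?_
    rw [← mul_add]
    refine mul_le_mul_of_nonneg_left ?_ (hw l)
    have := subNorm_add_le (G l) (βs + γ) ((-1 : ℝ) • γ)
    rw [subNorm_smul] at this
    simpa using this
  linarith

lemma card_expandedSupport (hG : IsGrouping G) (βs : EuclideanSpace ℝ (Fin p)) :
    ((expandedSupport G βs).card : ℝ) = ∑ l ∈ activeGroups G βs, ((G l).card : ℝ) := by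
  rw [expandedSupport, Finset.card_biUnion fun l _ m _ h => hG.disjoint l m h]
  push_cast
  rfl

lemma cSupport_sq (hG : IsGrouping G) (hw : ∀ l, w l = √((G l).card : ℝ))
    (βs : EuclideanSpace ℝ (Fin p)) : cSupport G w βs ^ 2 = (expandedSupport G βs).card := by
  rw [cSupport, Real.sq_sqrt (Finset.sum_nonneg fun l _ => sq_nonneg _), card_expandedSupport hG]
  exact Finset.sum_congr rfl fun l _ => by rw [hw, Real.sq_sqrt (by positivity)]

lemma cMax_eq_one (hG : IsGrouping G) (hw : ∀ l, w l = √((G l).card : ℝ)) (hp : 0 < p) :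
    cMax G w = 1 := by
  obtain ⟨l, -⟩ := hG.cover ⟨0, hp⟩
  have : Nonempty (Fin g) := ⟨l⟩
  have : ∀ l, (w l)⁻¹ * √((G l).card : ℝ) = 1 := fun l => by
    rw [hw]
    have := (hG.nonempty l).card_pos
    exact inv_mul_cancel₀ (by positivity)
  simp [cMax, this]

/-- Cauchy–Schwarz over the active groups, whose squared weights sum to `|Ω|`. -/
lemma groupPenalty_proj_le (hG : IsGrouping G) (hw : ∀ l, w l = √((G l).card : ℝ))
    (βs γ : EuclideanSpace ℝ (Fin p)) :
    groupPenalty G w (proj (expandedSupport G βs) γ)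
      ≤ √((expandedSupport G βs).card : ℝ) * ‖γ‖ := by
  rw [groupPenalty_proj hG, EuclideanSpace.norm_eq]
  refine (Real.sum_mul_le_sqrt_mul_sqrt _ _ _).trans ?_
  have h1 : ∑ l ∈ activeGroups G βs, w l ^ 2 = (expandedSupport G βs).card := by
    rw [card_expandedSupport hG]
    exact Finset.sum_congr rfl fun l _ => by rw [hw, Real.sq_sqrt (by positivity)]
  rw [h1]
  refine mul_le_mul_of_nonneg_left (Real.sqrt_le_sqrt ?_) (Real.sqrt_nonneg _)
  rw [sum_eq_sum_groups hG]
  have h2 : ∀ l, subNorm (G l) γ ^ 2 = ∑ j ∈ G l, ‖γ j‖ ^ 2 := fun l => by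
    rw [subNorm, Real.sq_sqrt (Finset.sum_nonneg fun l _ => sq_nonneg _)]
    simp
  simp only [h2]
  exact Finset.sum_le_sum_of_subset_of_nonneg (Finset.subset_univ _)
    fun l _ _ => Finset.sum_nonneg fun j _ => sq_nonneg _

lemma groupPenalty_zero : groupPenalty G w 0 = 0 :=
  Finset.sum_eq_zero fun l _ => by rw [subNorm_eq_zero fun j _ => by simp, mul_zero]

/-- Needed because the real supremum of an unbounded set is `0` by convention. -/
lemma dualPenalty_set_bddAbove (hG : IsGrouping G) (hw : ∀ l, w l = √((G l).card : ℝ))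
    (y : EuclideanSpace ℝ (Fin p)) :
    BddAbove {t : ℝ | ∃ x : EuclideanSpace ℝ (Fin p), groupPenalty G w x ≤ 1 ∧ t = inner ℝ x y} := by
  refine ⟨‖y‖, ?_⟩
  rintro t ⟨x, hx, rfl⟩
  refine (real_inner_le_norm x y).trans ?_
  exact mul_le_of_le_one_left (norm_nonneg _) ((norm_le_groupPenalty hG hw x).trans hx)

lemma dualPenalty_nonneg (hG : IsGrouping G) (hw : ∀ l, w l = √((G l).card : ℝ))
    (y : EuclideanSpace ℝ (Fin p)) : 0 ≤ dualPenalty G w y :=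
  le_csSup (dualPenalty_set_bddAbove hG hw y) ⟨0, by rw [groupPenalty_zero]; norm_num, by simp⟩

/-- The generalized Cauchy–Schwarz inequality of the dual norm. -/
lemma inner_le_groupPenalty_mul_dualPenalty (hG : IsGrouping G)
    (hw : ∀ l, w l = √((G l).card : ℝ)) (x y : EuclideanSpace ℝ (Fin p)) :
    inner ℝ x y ≤ groupPenalty G w x * dualPenalty G w y := by
  rcases eq_or_ne x 0 with rfl | hx
  · simp [groupPenalty_zero]
  have hpos : 0 < groupPenalty G w x :=
    (norm_pos_iff.2 hx).trans_le (norm_le_groupPenalty hG hw x)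
  have := le_csSup (dualPenalty_set_bddAbove hG hw y)
    ⟨(groupPenalty G w x)⁻¹ • x, by
      rw [groupPenalty_smul, abs_of_pos (inv_pos.2 hpos), inv_mul_cancel₀ hpos.ne'], rfl⟩
  rw [real_inner_smul_left] at this
  have h := mul_le_mul_of_nonneg_left this hpos.le
  rwa [← mul_assoc, mul_inv_cancel₀ hpos.ne', one_mul] at h

/-- Hölder, with the `ℓ₁` norm bounded by `Ψ`. This reduces the dual norm to `p` coordinates, ready
for a union bound. -/
lemma dualPenalty_le (hG : IsGrouping G) (hw : ∀ l, w l = √((G l).card : ℝ))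
    {y : EuclideanSpace ℝ (Fin p)} {B : ℝ} (hB : 0 ≤ B) (hy : ∀ j, |y j| ≤ B) :
    dualPenalty G w y ≤ B := by
  refine csSup_le ⟨_, 0, by rw [groupPenalty_zero]; norm_num, rfl⟩ ?_
  rintro t ⟨x, hx, rfl⟩
  calc inner ℝ x y = ∑ j, x j * y j := by
        simp [PiLp.inner_apply, mul_comm]
    _ ≤ ∑ j, |x j| * B := Finset.sum_le_sum fun j _ => by
        refine (le_abs_self _).trans ?_
        rw [abs_mul]
        exact mul_le_mul_of_nonneg_left (hy j) (abs_nonneg _)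
    _ = (∑ j, |x j|) * B := by rw [Finset.sum_mul]
    _ ≤ B := mul_le_of_le_one_left hB ((l1_le_groupPenalty hG hw x).trans hx)

end Norms

/-! ### Convexity and subgradients of the rank loss; the cone condition -/

section RankLoss

variable {n p g : ℕ}

lemma rankLoss_eq (u : Fin n → ℝ) :
    rankLoss u = 1 / ((n : ℝ) * ((n : ℝ) - 1)) * ∑ i, ∑ j, |u i - u j| := by
  unfold rankLoss
  congr 1
  refine Finset.sum_congr rfl fun i _ => ?_
  rw [← Finset.sum_erase_add _ _ (Finset.mem_univ i)]
  simp

lemma pairWeight_nonneg : 0 ≤ 1 / ((n : ℝ) * ((n : ℝ) - 1)) := by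
  rcases Nat.eq_zero_or_pos n with rfl | h
  · simp
  · have : (1 : ℝ) ≤ n := by exact_mod_cast h
    have : 0 ≤ (n : ℝ) - 1 := by linarith
    positivity

lemma rankLoss_nonneg (u : Fin n → ℝ) : 0 ≤ rankLoss u := by
  rw [rankLoss_eq]
  exact mul_nonneg pairWeight_nonneg
    (Finset.sum_nonneg fun i _ => Finset.sum_nonneg fun j _ => abs_nonneg _)

lemma continuous_rankLoss : Continuous (rankLoss : (Fin n → ℝ) → ℝ) := by
  unfold rankLoss
  fun_prop

lemma rankLoss_convex (u v : Fin n → ℝ) {t : ℝ} (h0 : 0 ≤ t) (h1 : t ≤ 1) :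
    rankLoss ((1 - t) • u + t • v) ≤ (1 - t) * rankLoss u + t * rankLoss v := by
  simp only [rankLoss_eq]
  have : ∑ i, ∑ j, |((1 - t) • u + t • v) i - ((1 - t) • u + t • v) j|
      ≤ (1 - t) * ∑ i, ∑ j, |u i - u j| + t * ∑ i, ∑ j, |v i - v j| := by
    simp only [Finset.mul_sum, ← Finset.sum_add_distrib]
    refine Finset.sum_le_sum fun i _ => Finset.sum_le_sum fun j _ => ?_
    have h : ((1 - t) • u + t • v) i - ((1 - t) • u + t • v) j
        = (1 - t) * (u i - u j) + t * (v i - v j) := by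
      simp only [Pi.add_apply, Pi.smul_apply, smul_eq_mul]; ring
    rw [h]
    refine (abs_add_le _ _).trans ?_
    rw [abs_mul, abs_mul, abs_of_nonneg h0, abs_of_nonneg (sub_nonneg.2 h1)]
  have := mul_le_mul_of_nonneg_left this (pairWeight_nonneg (n := n))
  linarith

variable {G : Fin g → Finset (Fin p)} {w : Fin g → ℝ}

lemma continuous_objective (X : Matrix (Fin n) (Fin p) ℝ) (y : Fin n → ℝ) (lam : ℝ) :
    Continuous (objective X y G w lam) := by
  unfold objective
  refine (continuous_rankLoss.comp ?_).add (continuous_const.mul continuous_groupPenalty)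
  exact (Continuous.matrix_mulVec continuous_const (PiLp.continuous_ofLp 2 _)).sub continuous_const

lemma objective_segment_le (hw : ∀ l, 0 ≤ w l) (X : Matrix (Fin n) (Fin p) ℝ) (y : Fin n → ℝ)
    {lam : ℝ} (hlam : 0 ≤ lam) (β γ : EuclideanSpace ℝ (Fin p)) {t : ℝ} (h0 : 0 ≤ t)
    (h1 : t ≤ 1) :
    objective X y G w lam (β + t • γ)
      ≤ (1 - t) * objective X y G w lam β + t * objective X y G w lam (β + γ) := by
  unfold objective
  have e1 : X *ᵥ (β + t • γ).ofLp - y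
      = (1 - t) • (X *ᵥ β.ofLp - y) + t • (X *ᵥ (β + γ).ofLp - y) := by
    ext i
    simp [mulVec_add, mulVec_smul]
    ring
  have e2 : β + t • γ = (1 - t) • β + t • (β + γ) := by module
  have l1 := rankLoss_convex (X *ᵥ β.ofLp - y) (X *ᵥ (β + γ).ofLp - y) h0 h1
  have l2 : groupPenalty G w (β + t • γ)
      ≤ (1 - t) * groupPenalty G w β + t * groupPenalty G w (β + γ) := by
    rw [e2]
    refine (groupPenalty_add_le hw _ _).trans ?_
    rw [groupPenalty_smul, groupPenalty_smul, abs_of_nonneg h0, abs_of_nonneg (sub_nonneg.2 h1)]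
  rw [e1]
  have := mul_le_mul_of_nonneg_left l2 hlam
  linarith

/-- The loss is nonnegative and the penalty dominates `lam * ‖β‖`, so the continuous objective is
coercive whatever the design. -/
lemma exists_isEstimator (hG : IsGrouping G) (hw : ∀ l, w l = √((G l).card : ℝ))
    (X : Matrix (Fin n) (Fin p) ℝ) (y : Fin n → ℝ) {lam : ℝ} (hlam : 0 < lam) :
    ∃ β, IsEstimator X y G w lam β := by
  obtain ⟨β, hβ⟩ := (continuous_objective X y lam (G := G) (w := w)).exists_forall_le (by
    refine Filter.tendsto_atTop_mono (f := fun β => lam * ‖β‖) (fun β => ?_)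
      (tendsto_norm_cocompact_atTop.const_mul_atTop hlam)
    have := mul_le_mul_of_nonneg_left (norm_le_groupPenalty hG hw β) hlam.le
    have h := rankLoss_nonneg (X *ᵥ β.ofLp - y)
    unfold objective
    linarith)
  exact ⟨β, fun x _ => hβ x⟩

/-- The sign of the difference of the ranks of `i` and `j`. -/
def orderSign (r : Equiv.Perm (Fin n)) (i j : Fin n) : ℝ :=
  if r j < r i then 1 else if r i < r j then -1 else 0

lemma orderSign_swap (r : Equiv.Perm (Fin n)) (i j : Fin n) :
    orderSign r j i = -orderSign r i j := by
  unfold orderSign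
  rcases lt_trichotomy (r i) (r j) with h | h | h
  · simp [h, h.not_gt]
  · simp [h]
  · simp [h, h.not_gt]

/-- An index of rank `ρ` has `ρ - 1` indices below it and `n - ρ` above, and the difference is `2ρ -
(n + 1)`. -/
lemma rankScore_eq_sum (r : Equiv.Perm (Fin n)) (i : Fin n) :
    rankScore r i = ∑ j, orderSign r i j := by
  have h : ∑ j, orderSign r i j
      = ∑ k : Fin n, ((if k < r i then (1 : ℝ) else 0) - (if r i < k then 1 else 0)) := by
    rw [← Equiv.sum_comp r fun k =>
      ((if k < r i then (1 : ℝ) else 0) - (if r i < k then 1 else 0))]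
    refine Finset.sum_congr rfl fun j _ => ?_
    unfold orderSign
    rcases lt_trichotomy (r i) (r j) with h | h | h
    · simp [h, h.not_gt]
    · simp [h]
    · simp [h, h.not_gt]
  have h2 : (Finset.univ.filter fun k => k < r i) = Finset.Iio (r i) := by ext; simp
  have h3 : (Finset.univ.filter fun k => r i < k) = Finset.Ioi (r i) := by ext; simp
  rw [h, Finset.sum_sub_distrib, Finset.sum_boole, Finset.sum_boole, h2, h3, Fin.card_Iio,
    Fin.card_Ioi, rankScore]
  have := (r i).isLt
  rw [Nat.cast_sub (by omega), Nat.cast_sub (by omega)]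
  push_cast
  ring

lemma sum_mul_rankScore (r : Equiv.Perm (Fin n)) (v : Fin n → ℝ) :
    2 * ∑ i, v i * rankScore r i = ∑ i, ∑ j, (v i - v j) * orderSign r i j := by
  have h1 : ∑ i, ∑ j, v j * orderSign r i j = -∑ i, ∑ j, v i * orderSign r i j := by
    rw [Finset.sum_comm, ← Finset.sum_neg_distrib]
    refine Finset.sum_congr rfl fun i _ => ?_
    rw [← Finset.sum_neg_distrib]
    exact Finset.sum_congr rfl fun j _ => by rw [orderSign_swap]; ring
  simp only [sub_mul, Finset.sum_sub_distrib, h1, rankScore_eq_sum, Finset.mul_sum]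
  simp only [← Finset.mul_sum]
  ring

/-- Writes the gradient with the pair weights of the rank loss, so that the two can be compared pair
by pair. -/
lemma inner_rankGradient (X : Matrix (Fin n) (Fin p) ℝ) (r : Equiv.Perm (Fin n))
    (γ : EuclideanSpace ℝ (Fin p)) :
    inner ℝ γ (rankGradient X r) = -(1 / ((n : ℝ) * ((n : ℝ) - 1)) *
      ∑ i, ∑ j, ((X *ᵥ γ.ofLp) i - (X *ᵥ γ.ofLp) j) * orderSign r i j) := by
  rw [← sum_mul_rankScore]
  have h : inner ℝ γ (rankGradient X r)
      = -(2 / ((n : ℝ) * ((n : ℝ) - 1))) * (γ.ofLp ⬝ᵥ (Xᵀ *ᵥ rankScore r)) := by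
    simp only [rankGradient, PiLp.inner_apply, dotProduct, Finset.mul_sum]
    refine Finset.sum_congr rfl fun j _ => ?_
    simp
    ring
  rw [h, dotProduct_mulVec, vecMul_transpose]
  simp only [dotProduct]
  ring

/-- The rank gradient at any ordering compatible with the errors is a subgradient of the rank
loss. -/
lemma inner_rankGradient_le (X : Matrix (Fin n) (Fin p) ℝ) {r : Equiv.Perm (Fin n)}
    {e : Fin n → ℝ} (hr : ∀ i j, r i < r j → e i ≤ e j) (γ : EuclideanSpace ℝ (Fin p)) :
    inner ℝ γ (rankGradient X r) ≤ rankLoss (X *ᵥ γ.ofLp - e) - rankLoss (-e) := by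
  rw [inner_rankGradient, rankLoss_eq, rankLoss_eq, ← mul_sub, neg_mul_eq_mul_neg]
  refine mul_le_mul_of_nonneg_left ?_ pairWeight_nonneg
  simp only [← Finset.sum_neg_distrib, ← Finset.sum_sub_distrib]
  -- For each pair this is `|u| ≥ ±u`. The residual at `βs` is `-e`, whose order is opposite to that
  -- of `r`; hence the minus sign in `Sₙ`.
  refine Finset.sum_le_sum fun i _ => Finset.sum_le_sum fun j _ => ?_
  simp only [Pi.sub_apply, Pi.neg_apply]
  set a := (X *ᵥ γ.ofLp) i
  set b := (X *ᵥ γ.ofLp) j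
  unfold orderSign
  rcases lt_trichotomy (r i) (r j) with h | h | h
  · have := hr i j h
    rw [if_neg h.not_gt, if_pos h, abs_of_nonneg (a := -e i - -e j) (by linarith)]
    linarith [le_abs_self (a - e i - (b - e j))]
  · have := r.injective h
    subst this
    simp
  · have := hr j i h
    rw [if_pos h, abs_of_nonpos (a := -e i - -e j) (by linarith)]
    linarith [neg_le_abs (a - e i - (b - e j))]

lemma objective_add_sub (X : Matrix (Fin n) (Fin p) ℝ) (e : Fin n → ℝ) (lam : ℝ)
    (βs γ : EuclideanSpace ℝ (Fin p)) :
    objective X (X *ᵥ βs.ofLp + e) G w lam (βs + γ) - objective X (X *ᵥ βs.ofLp + e) G w lam βs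
      = rankLoss (X *ᵥ γ.ofLp - e) - rankLoss (-e)
        - lam * (groupPenalty G w βs - groupPenalty G w (βs + γ)) := by
  unfold objective
  have e1 : X *ᵥ (βs + γ).ofLp - (X *ᵥ βs.ofLp + e) = X *ᵥ γ.ofLp - e := by
    ext i; simp [mulVec_add]
  have e2 : X *ᵥ βs.ofLp - (X *ᵥ βs.ofLp + e) = -e := by
    ext i; simp
  rw [e1, e2]
  ring

/-- If the penalty level dominates the dual norm of the gradient, perturbations that do not
increase the objective lie in the cone of the restricted eigenvalue condition. -/
lemma mem_cone (hG : IsGrouping G) (hw : ∀ l, w l = √((G l).card : ℝ))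
    (X : Matrix (Fin n) (Fin p) ℝ) {r : Equiv.Perm (Fin n)} {e : Fin n → ℝ}
    (hr : ∀ i j, r i < r j → e i ≤ e j) {lam c₀ : ℝ} (hc₀ : 1 < c₀) (hlam : 0 < lam)
    (hdual : c₀ * dualPenalty G w (rankGradient X r) ≤ lam) {βs γ : EuclideanSpace ℝ (Fin p)}
    (hobj : objective X (X *ᵥ βs.ofLp + e) G w lam (βs + γ)
      ≤ objective X (X *ᵥ βs.ofLp + e) G w lam βs) :
    groupPenalty G w (proj (expandedSupport G βs)ᶜ γ)
      ≤ (cBar c₀ - 1) * groupPenalty G w (proj (expandedSupport G βs) γ) := by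
  have hw0 : ∀ l, 0 ≤ w l := fun l => by rw [hw]; positivity
  have h1 := objective_add_sub (G := G) (w := w) X e lam βs γ
  have h2 := inner_rankGradient_le X hr γ
  have h3 := inner_le_groupPenalty_mul_dualPenalty hG hw (-γ) (rankGradient X r)
  have h4 : groupPenalty G w (-γ) = groupPenalty G w γ := by
    have := groupPenalty_smul (G := G) (w := w) (-1) γ
    simpa using this
  rw [inner_neg_left, h4] at h3
  have h5 := mul_le_mul_of_nonneg_left (groupPenalty_sub_le hG hw0 βs γ) hlam.le
  have h6 := mul_le_mul_of_nonneg_left hdual (groupPenalty_nonneg (G := G) hw0 γ)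
  have h7 := groupPenalty_eq_add (w := w) hG βs γ
  set a := groupPenalty G w (proj (expandedSupport G βs) γ)
  set b := groupPenalty G w (proj (expandedSupport G βs)ᶜ γ)
  -- The chain `-Ψ(γ) Ψᵈ(Sₙ) ≤ ⟨γ, Sₙ⟩ ≤` loss increase `≤ lam (a - b)` is multiplied by `c₀`, using
  -- `Ψ(γ) = a + b`. What remains is `(c₀ - 1) b ≤ (c₀ + 1) a`.
  have h8 : lam * (c₀ * (b - a)) ≤ lam * (a + b) := by
    have : c₀ * (lam * (b - a)) ≤ c₀ * (groupPenalty G w γ * dualPenalty G w (rankGradient X r)) :=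
      mul_le_mul_of_nonneg_left (by linarith) (by linarith)
    rw [← h7]
    linarith
  have h9 := le_of_mul_le_mul_left h8 hlam
  rw [cBar, add_sub_cancel_left, div_mul_eq_mul_div, le_div_iff₀ (by linarith)]
  linarith

end RankLoss

/-! ### Hoeffding's representation and tails of linear rank statistics -/

section Permutations

variable {n p g : ℕ}

lemma exists_perm_pair {α : Type*} [DecidableEq α] {a b a' b' : α} (h : a ≠ b) (h' : a' ≠ b') :
    ∃ τ : Equiv.Perm α, τ a = a' ∧ τ b = b' := by
  refine ⟨Equiv.swap (Equiv.swap a a' b) b' * Equiv.swap a a', ?_, by simp⟩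
  rw [Equiv.Perm.mul_apply, Equiv.swap_apply_left]
  refine Equiv.swap_apply_of_ne_of_ne (fun e => h ?_) h'
  have := (Equiv.swap a a').injective (e.symm.trans (Equiv.swap_apply_left a a').symm)
  exact this.symm

/-- Averaging over permutations is averaging over ordered pairs of distinct indices. -/
lemma sum_perm_pair (f : Fin n → Fin n → ℝ) {a b : Fin n} (hab : a ≠ b) :
    ((n : ℝ) * ((n : ℝ) - 1)) * ∑ π : Equiv.Perm (Fin n), f (π a) (π b)
      = (Nat.factorial n : ℝ) * ∑ i, ∑ j ∈ Finset.univ.erase i, f i j := by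
  -- Right translation by a permutation carrying `(a, b)` to `(i, j)` is a bijection, so all ordered
  -- pairs give the same sum; the double sum is then counted in two ways.
  have key : ∀ i, ∀ j ∈ Finset.univ.erase i, ∑ π : Equiv.Perm (Fin n), f (π i) (π j)
      = ∑ π : Equiv.Perm (Fin n), f (π a) (π b) := by
    intro i j hj
    obtain ⟨τ, rfl, rfl⟩ := exists_perm_pair hab (Finset.ne_of_mem_erase hj).symm
    exact Equiv.sum_comp (Equiv.mulRight τ) fun π => f (π a) (π b)
  have h1 : ∑ i, ∑ j ∈ Finset.univ.erase i, ∑ π : Equiv.Perm (Fin n), f (π i) (π j)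
      = ((n : ℝ) * ((n : ℝ) - 1)) * ∑ π : Equiv.Perm (Fin n), f (π a) (π b) := by
    rw [Finset.sum_congr rfl fun i _ => Finset.sum_congr rfl (key i)]
    have hn : 1 ≤ n := by have := a.isLt; omega
    simp [Finset.card_erase_of_mem, Nat.cast_sub hn]
    ring
  have h2 : ∑ i, ∑ j ∈ Finset.univ.erase i, ∑ π : Equiv.Perm (Fin n), f (π i) (π j)
      = ∑ π : Equiv.Perm (Fin n), ∑ i, ∑ j ∈ Finset.univ.erase i, f i j := by
    rw [Finset.sum_congr rfl fun i _ => Finset.sum_comm, Finset.sum_comm]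
    refine Finset.sum_congr rfl fun π _ => ?_
    rw [← Equiv.sum_comp π fun i => ∑ j ∈ Finset.univ.erase i, f i j]
    refine Finset.sum_congr rfl fun i _ => ?_
    refine Finset.sum_equiv π (fun j => ?_) fun j _ => rfl
    simp
  rw [← h1, h2, Finset.sum_const, Finset.card_univ, Fintype.card_perm, Fintype.card_fin,
    nsmul_eq_mul]

/-- The first index of the `k`-th of the `n / 2` disjoint pairs of consecutive indices. -/
def pairFst (k : Fin (n / 2)) : Fin n := ⟨2 * k, by have := k.isLt; omega⟩

/-- The second index of the `k`-th of the `n / 2` disjoint pairs of consecutive indices. -/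
def pairSnd (k : Fin (n / 2)) : Fin n := ⟨2 * k + 1, by have := k.isLt; omega⟩

lemma pairFst_ne_pairSnd (k l : Fin (n / 2)) : pairFst k ≠ pairSnd l := by
  simp only [pairFst, pairSnd, ne_eq, Fin.mk.injEq]
  omega

lemma pairFst_injective : Function.Injective (pairFst : Fin (n / 2) → Fin n) := by
  intro k l h
  simp only [pairFst, Fin.mk.injEq] at h
  exact Fin.ext (by omega)

lemma pairSnd_injective : Function.Injective (pairSnd : Fin (n / 2) → Fin n) := by
  intro k l h
  simp only [pairSnd, Fin.mk.injEq] at h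
  exact Fin.ext (by omega)

/-- Hoeffding's representation of a U-statistic as an average, over permutations, of averages over
disjoint pairs. -/
lemma uStatistic_eq_average (hn : 2 ≤ n) (f : Fin n → Fin n → ℝ) :
    1 / ((n : ℝ) * ((n : ℝ) - 1)) * ∑ i, ∑ j ∈ Finset.univ.erase i, f i j
      = ∑ π : Equiv.Perm (Fin n), (Nat.factorial n : ℝ)⁻¹ *
          ∑ k : Fin (n / 2), ((n / 2 : ℕ) : ℝ)⁻¹ * f (π (pairFst k)) (π (pairSnd k)) := by
  have hn' : (2 : ℝ) ≤ n := by exact_mod_cast hn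
  have hN : (n : ℝ) * ((n : ℝ) - 1) ≠ 0 := mul_ne_zero (by linarith) (by linarith)
  have hf : (Nat.factorial n : ℝ) ≠ 0 := by exact_mod_cast Nat.factorial_ne_zero n
  have hm : ((n / 2 : ℕ) : ℝ) ≠ 0 := by
    have : n / 2 ≠ 0 := by omega
    exact_mod_cast this
  rw [← Finset.mul_sum, Finset.sum_comm]
  simp only [← Finset.mul_sum]
  have h : ∀ k : Fin (n / 2), ∑ π : Equiv.Perm (Fin n), f (π (pairFst k)) (π (pairSnd k))
      = (Nat.factorial n : ℝ) * (1 / ((n : ℝ) * ((n : ℝ) - 1)) *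
        ∑ i, ∑ j ∈ Finset.univ.erase i, f i j) := fun k => by
    have := sum_perm_pair f (pairFst_ne_pairSnd k k)
    rw [mul_left_comm, ← this, one_div, inv_mul_cancel_left₀ hN]
  rw [Finset.sum_congr rfl fun k _ => h k]
  simp only [Finset.sum_const, Finset.card_univ, Fintype.card_fin, nsmul_eq_mul]
  field_simp

lemma exp_average_le {ι : Type*} (s : Finset ι) {c : ℝ} (hc : 0 ≤ c)
    (h1 : ∑ _i ∈ s, c = 1) (x : ι → ℝ) :
    Real.exp (∑ i ∈ s, c * x i) ≤ ∑ i ∈ s, c * Real.exp (x i) := by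
  have := convexOn_exp.map_sum_le (t := s) (w := fun _ => c) (p := x) (fun _ _ => hc) h1
    (fun _ _ => Set.mem_univ _)
  simpa using this

lemma sum_perm_inv_factorial :
    ∑ _π : Equiv.Perm (Fin n), (Nat.factorial n : ℝ)⁻¹ = 1 := by
  have hf : (Nat.factorial n : ℝ) ≠ 0 := by exact_mod_cast Nat.factorial_ne_zero n
  simp [Finset.card_univ, Fintype.card_perm, hf]

lemma orderSign_mul (r τ : Equiv.Perm (Fin n)) (i j : Fin n) :
    orderSign (r * τ) i j = orderSign r (τ i) (τ j) := rfl

lemma orderSign_eq_one_or {r : Equiv.Perm (Fin n)} {i j : Fin n} (h : i ≠ j) :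
    orderSign r i j = 1 ∨ orderSign r i j = -1 := by
  unfold orderSign
  rcases lt_trichotomy (r i) (r j) with h' | h' | h'
  · simp [h', h'.not_gt]
  · exact absurd (r.injective h') h
  · simp [h']

/-- Under a uniform permutation, the order signs of disjoint pairs are independent Rademacher
variables. -/
lemma sum_exp_orderSign (c : Fin (n / 2) → ℝ) (K : Finset (Fin (n / 2))) :
    ∑ r : Equiv.Perm (Fin n),
        Real.exp (∑ k ∈ K, c k * orderSign r (pairFst k) (pairSnd k))
      = (Nat.factorial n : ℝ) * ∏ k ∈ K, Real.cosh (c k) := by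
  classical
  induction K using Finset.induction_on with
  | empty => simp [Finset.card_univ, Fintype.card_perm]
  | insert k K hk ih =>
    rw [Finset.prod_insert hk, mul_left_comm, ← ih, Finset.mul_sum]
    set F : Equiv.Perm (Fin n) → ℝ := fun r =>
      Real.exp (∑ k ∈ K, c k * orderSign r (pairFst k) (pairSnd k)) with hF
    set τ : Equiv.Perm (Fin n) := Equiv.swap (pairFst k) (pairSnd k) with hτ
    -- Transposing the `k`-th pair flips its sign and leaves the other disjoint pairs alone, so
    -- averaging `r` with `r * τ` produces `cosh`.
    have hFτ : ∀ r, F (r * τ) = F r := fun r => by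
      simp only [hF]
      congr 1
      refine Finset.sum_congr rfl fun l hl => ?_
      have hlk : l ≠ k := fun h => hk (h ▸ hl)
      rw [orderSign_mul, hτ,
        Equiv.swap_apply_of_ne_of_ne (pairFst_injective.ne hlk) (pairFst_ne_pairSnd _ _),
        Equiv.swap_apply_of_ne_of_ne (pairFst_ne_pairSnd _ _).symm (pairSnd_injective.ne hlk)]
    have h0 : ∀ r : Equiv.Perm (Fin n),
        Real.exp (∑ k ∈ insert k K, c k * orderSign r (pairFst k) (pairSnd k))
          = Real.exp (c k * orderSign r (pairFst k) (pairSnd k)) * F r := fun r => by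
      rw [Finset.sum_insert hk, Real.exp_add]
    have h1 : ∑ r, Real.exp (c k * orderSign r (pairFst k) (pairSnd k)) * F r
        = ∑ r, Real.exp (-(c k * orderSign r (pairFst k) (pairSnd k))) * F r := by
      rw [← Equiv.sum_comp (Equiv.mulRight τ)]
      refine Finset.sum_congr rfl fun r _ => ?_
      rw [Equiv.coe_mulRight, hFτ, orderSign_mul, hτ, Equiv.swap_apply_left,
        Equiv.swap_apply_right, orderSign_swap, mul_neg]
    have h2 : ∀ r : Equiv.Perm (Fin n),
        Real.exp (c k * orderSign r (pairFst k) (pairSnd k)) * F r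
          + Real.exp (-(c k * orderSign r (pairFst k) (pairSnd k))) * F r
        = 2 * (Real.cosh (c k) * F r) := fun r => by
      rw [Real.cosh_eq]
      rcases orderSign_eq_one_or (r := r) (pairFst_ne_pairSnd k k) with h | h <;> rw [h] <;>
        simp only [mul_one, mul_neg, neg_neg] <;> ring
    have h3 := Finset.sum_congr (rfl : (Finset.univ : Finset (Equiv.Perm (Fin n))) = _)
      fun r _ => h2 r
    rw [Finset.sum_add_distrib, ← h1, ← Finset.mul_sum] at h3
    rw [Finset.sum_congr rfl fun r _ => h0 r]
    linarith

lemma prod_cosh_le {m : ℕ} {c : Fin m → ℝ} {B : ℝ} (hc : ∀ k, |c k| ≤ B) :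
    ∏ k, Real.cosh (c k) ≤ Real.exp (m * (B ^ 2 / 2)) := by
  calc ∏ k, Real.cosh (c k) ≤ ∏ _k : Fin m, Real.exp (B ^ 2 / 2) := by
        refine Finset.prod_le_prod (fun k _ => (Real.cosh_pos _).le) fun k _ => ?_
        refine (Real.cosh_le_exp_half_sq _).trans (Real.exp_le_exp.2 ?_)
        have := sq_le_sq' (neg_le_of_abs_le (hc k)) (le_of_abs_le (hc k))
        linarith
    _ = _ := by simp [← Real.exp_nat_mul]

/-- The linear rank statistic with scores `a`, written as a U-statistic. -/
noncomputable def rankStatistic (a : Fin n → ℝ) (r : Equiv.Perm (Fin n)) : ℝ :=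
  1 / ((n : ℝ) * ((n : ℝ) - 1)) *
    ∑ i, ∑ j ∈ Finset.univ.erase i, (a i - a j) * orderSign r i j

lemma rankGradient_apply (X : Matrix (Fin n) (Fin p) ℝ) (r : Equiv.Perm (Fin n)) (j : Fin p) :
    rankGradient X r j = -rankStatistic (fun i => X i j) r := by
  have h : ∑ i, ∑ l ∈ Finset.univ.erase i, (X i j - X l j) * orderSign r i l
      = ∑ i, ∑ l, (X i j - X l j) * orderSign r i l :=
    Finset.sum_congr rfl fun i _ => by
      rw [← Finset.sum_erase_add _ _ (Finset.mem_univ i)]; simp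
  rw [rankStatistic, h, ← sum_mul_rankScore, rankGradient]
  generalize (n : ℝ) * ((n : ℝ) - 1) = N
  simp [mulVec, dotProduct]
  ring

/-- Jensen over the permutations `π`; for fixed `π` the relabelling `r * π` is again uniform, so its
pair signs are Rademacher. The `m = n / 2` coefficients are at most `2|s|b / m`, and `m (2sb/m)² / 2
= 2s²b²/m`. -/
lemma sum_exp_rankStatistic_le (hn : 2 ≤ n) {a : Fin n → ℝ} {b : ℝ} (ha : ∀ i, |a i| ≤ b)
    (s : ℝ) :
    ∑ r, Real.exp (s * rankStatistic a r)
      ≤ (Nat.factorial n : ℝ) * Real.exp (2 * s ^ 2 * b ^ 2 / (n / 2 : ℕ)) := by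
  have hm : (0 : ℝ) < (n / 2 : ℕ) := by
    have : 0 < n / 2 := by omega
    exact_mod_cast this
  set m : ℝ := ((n / 2 : ℕ) : ℝ) with hm_def
  have hf : (0 : ℝ) < (Nat.factorial n : ℝ) := by exact_mod_cast Nat.factorial_pos n
  set c : Equiv.Perm (Fin n) → Fin (n / 2) → ℝ := fun π k =>
    s * m⁻¹ * (a (π (pairFst k)) - a (π (pairSnd k))) with hc
  have h1 : ∀ r, Real.exp (s * rankStatistic a r)
      ≤ ∑ π : Equiv.Perm (Fin n), (Nat.factorial n : ℝ)⁻¹ *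
        Real.exp (∑ k, c π k * orderSign (r * π) (pairFst k) (pairSnd k)) := fun r => by
    have e : s * rankStatistic a r = ∑ π : Equiv.Perm (Fin n), (Nat.factorial n : ℝ)⁻¹ *
        ∑ k, c π k * orderSign (r * π) (pairFst k) (pairSnd k) := by
      rw [rankStatistic, uStatistic_eq_average hn, Finset.mul_sum]
      refine Finset.sum_congr rfl fun π _ => ?_
      rw [mul_left_comm, Finset.mul_sum]
      congr 1
      refine Finset.sum_congr rfl fun k _ => ?_
      rw [orderSign_mul]
      simp only [hc]
      ring
    rw [e]
    exact exp_average_le _ (by positivity) sum_perm_inv_factorial _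
  refine (Finset.sum_le_sum fun r _ => h1 r).trans ?_
  rw [Finset.sum_comm]
  simp only [← Finset.mul_sum]
  have h2 : ∀ π : Equiv.Perm (Fin n),
      ∑ r : Equiv.Perm (Fin n), Real.exp (∑ k, c π k * orderSign (r * π) (pairFst k) (pairSnd k))
        ≤ (Nat.factorial n : ℝ) * Real.exp (2 * s ^ 2 * b ^ 2 / m) := fun π => by
    have e := Equiv.sum_comp (Equiv.mulRight π) fun r : Equiv.Perm (Fin n) =>
      Real.exp (∑ k, c π k * orderSign r (pairFst k) (pairSnd k))
    simp only [Equiv.coe_mulRight] at e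
    rw [e, sum_exp_orderSign]
    refine mul_le_mul_of_nonneg_left ?_ hf.le
    have hB : ∀ k, |c π k| ≤ |s| * m⁻¹ * (2 * b) := fun k => by
      simp only [hc]
      rw [abs_mul, abs_mul, abs_of_pos (inv_pos.2 hm)]
      refine mul_le_mul_of_nonneg_left ?_ (by positivity)
      exact (abs_sub _ _).trans (by linarith [ha (π (pairFst k)), ha (π (pairSnd k))])
    refine (prod_cosh_le hB).trans (Real.exp_le_exp.2 (le_of_eq ?_))
    rw [← hm_def, mul_pow, mul_pow, sq_abs]
    field_simp
  refine (mul_le_mul_of_nonneg_left (Finset.sum_le_sum fun π _ => h2 π)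
    (by positivity)).trans (le_of_eq ?_)
  rw [Finset.sum_const, Finset.card_univ, Fintype.card_perm, Fintype.card_fin, nsmul_eq_mul]
  field_simp

/-- Sub-Gaussian tail bound for linear rank statistics of a uniform permutation. -/
lemma card_rankStatistic_gt_le (hn : 2 ≤ n) {a : Fin n → ℝ} {b : ℝ} (hb : 0 < b)
    (ha : ∀ i, |a i| ≤ b) {t : ℝ} (ht : 0 ≤ t) :
    ((Finset.univ.filter fun r => t < |rankStatistic a r|).card : ℝ)
      ≤ (Nat.factorial n : ℝ) * (2 * Real.exp (-(t ^ 2 * (n / 2 : ℕ) / (8 * b ^ 2)))) := by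
  have hm : (0 : ℝ) < (n / 2 : ℕ) := by
    have : 0 < n / 2 := by omega
    exact_mod_cast this
  set m : ℝ := ((n / 2 : ℕ) : ℝ) with hm_def
  -- The minimizer of the Chernoff exponent `2s²b²/m - st`.
  set s : ℝ := t * m / (4 * b ^ 2) with hs
  have hs0 : 0 ≤ s := by positivity
  have h1 : ((Finset.univ.filter fun r => t < |rankStatistic a r|).card : ℝ) * Real.exp (s * t)
      ≤ ∑ r, (Real.exp (s * rankStatistic a r) + Real.exp (-s * rankStatistic a r)) := by
    rw [← nsmul_eq_mul]
    refine (Finset.card_nsmul_le_sum _ _ _ fun r hr => ?_).trans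
      (Finset.sum_le_sum_of_subset_of_nonneg (Finset.subset_univ _) fun r _ _ => by positivity)
    have hr' : t < |rankStatistic a r| := by simpa using hr
    rcases le_abs.1 hr'.le with h | h
    · have : Real.exp (s * t) ≤ Real.exp (s * rankStatistic a r) :=
        Real.exp_le_exp.2 (mul_le_mul_of_nonneg_left h hs0)
      have := Real.exp_pos (-s * rankStatistic a r)
      linarith
    · have : Real.exp (s * t) ≤ Real.exp (-s * rankStatistic a r) :=
        Real.exp_le_exp.2 (by rw [neg_mul_comm]; exact mul_le_mul_of_nonneg_left h hs0)
      have := Real.exp_pos (s * rankStatistic a r)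
      linarith
  rw [Finset.sum_add_distrib] at h1
  have h2 := sum_exp_rankStatistic_le hn ha s
  have h3 := sum_exp_rankStatistic_le hn ha (-s)
  rw [neg_sq, ← hm_def] at h3
  have e : Real.exp (-(t ^ 2 * m / (8 * b ^ 2)))
      = Real.exp (2 * s ^ 2 * b ^ 2 / m) / Real.exp (s * t) := by
    rw [← Real.exp_sub]
    congr 1
    rw [hs]
    field_simp
    ring
  rw [e, ← mul_div_assoc, ← mul_div_assoc, le_div_iff₀ (Real.exp_pos _)]
  linarith

end Permutations

/-! ### The simulated quantile: attainment and size -/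

section Quantile

variable {n p g : ℕ}

lemma third_le_half (hn : 2 ≤ n) : (n : ℝ) / 3 ≤ (n / 2 : ℕ) := by
  have h : n ≤ 3 * (n / 2) := by omega
  have : (n : ℝ) ≤ 3 * (n / 2 : ℕ) := by exact_mod_cast h
  linarith

variable {X : Matrix (Fin n) (Fin p) ℝ} {G : Fin g → Finset (Fin p)} {w : Fin g → ℝ}

open Classical in
/-- The orderings at which the dual norm of the rank gradient is at most `t`. -/
noncomputable def dualSublevel (X : Matrix (Fin n) (Fin p) ℝ) (G : Fin g → Finset (Fin p))
    (w : Fin g → ℝ) (t : ℝ) : Finset (Equiv.Perm (Fin n)) :=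
  Finset.univ.filter fun r => dualPenalty G w (rankGradient X r) ≤ t

lemma dualGradientCDF_eq (t : ℝ) :
    dualGradientCDF X G w t = ((dualSublevel X G w t).card : ℝ) / (Nat.factorial n : ℝ) := by
  classical
  rw [dualGradientCDF, dualSublevel, Nat.card_eq_fintype_card, Fintype.card_subtype,
    Nat.card_eq_fintype_card, Fintype.card_perm, Fintype.card_fin]

/-- The dual norm is nonnegative, so the distribution function vanishes on negative numbers, while
`q > 0`. -/
lemma dualGradientCDF_set_bddBelow (hG : IsGrouping G) (hw : ∀ l, w l = √((G l).card : ℝ))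
    {q : ℝ} (hq : 0 < q) : BddBelow {t : ℝ | q ≤ dualGradientCDF X G w t} := by
  refine ⟨0, fun t ht => ?_⟩
  by_contra! h
  have : dualSublevel X G w t = ∅ :=
    Finset.filter_false_of_mem fun r _ => by
      have := dualPenalty_nonneg hG hw (rankGradient X r)
      linarith
  rw [Set.mem_ofPred_eq, dualGradientCDF_eq, this] at ht
  simp at ht
  linarith

/-- The infimum defining the quantile is attained. -/
lemma le_dualGradientCDF_sInf {q : ℝ} {t₀ : ℝ} (ht₀ : q ≤ dualGradientCDF X G w t₀) :
    q ≤ dualGradientCDF X G w (sInf {t : ℝ | q ≤ dualGradientCDF X G w t}) := by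
  classical
  set Q := sInf {t : ℝ | q ≤ dualGradientCDF X G w t}
  -- The dual norm takes finitely many values, none strictly between `Q` and the minimum of `F`; `Q
  -- + 1` only keeps `F` nonempty. Any `t` below that minimum has its sublevel set inside that of
  -- `Q`.
  set F : Finset ℝ := insert (Q + 1)
    ((Finset.univ.image fun r => dualPenalty G w (rankGradient X r)).filter fun v => Q < v) with hF
  have hne : F.Nonempty := Finset.insert_nonempty _ _
  have hlt : Q < F.min' hne := by
    rw [Finset.lt_min'_iff]
    intro v hv
    rw [hF, Finset.mem_insert, Finset.mem_filter] at hv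
    rcases hv with rfl | hv
    · linarith
    · exact hv.2
  obtain ⟨t, ht, htF⟩ := exists_lt_of_csInf_lt ⟨t₀, ht₀⟩ hlt
  refine le_trans ht ?_
  rw [dualGradientCDF_eq, dualGradientCDF_eq]
  refine div_le_div_of_nonneg_right ?_ (by positivity)
  refine Nat.cast_le.2 (Finset.card_le_card fun r hr => ?_)
  simp only [dualSublevel, Finset.mem_filter, Finset.mem_univ, true_and] at hr ⊢
  by_contra! h
  have : dualPenalty G w (rankGradient X r) ∈ F := by
    rw [hF, Finset.mem_insert, Finset.mem_filter]
    exact Or.inr ⟨Finset.mem_image_of_mem _ (Finset.mem_univ r), h⟩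
  have := F.min'_le _ this
  linarith

/-- The dual norm of the rank gradient is at most `8 b √(log p / n)` for all but a proportion `α`
of the permutations. -/
lemma le_dualGradientCDF (hG : IsGrouping G) (hw : ∀ l, w l = √((G l).card : ℝ)) (hn : 2 ≤ n)
    (hp : 2 ≤ p) {b α : ℝ} (hb : 0 < b) (hX : ∀ i j, |X i j| ≤ b) (hα : 0 < α)
    (hpα : 2 / α ≤ p) :
    1 - α ≤ dualGradientCDF X G w (8 * b * √(Real.log p / n)) := by
  classical
  have hn0 : (0 : ℝ) < n := by exact_mod_cast (by omega : 0 < n)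
  have hp0 : (0 : ℝ) < p := by exact_mod_cast (by omega : 0 < p)
  have hp1 : (1 : ℝ) ≤ p := by exact_mod_cast (by omega : 1 ≤ p)
  have hlog : 0 ≤ Real.log p := Real.log_nonneg hp1
  have hf : (0 : ℝ) < (Nat.factorial n : ℝ) := by exact_mod_cast Nat.factorial_pos n
  set t := 8 * b * √(Real.log p / n) with ht
  have ht0 : 0 ≤ t := by positivity
  have hexp : Real.exp (-(t ^ 2 * (n / 2 : ℕ) / (8 * b ^ 2))) ≤ ((p : ℝ) ^ 2)⁻¹ := by
    have h1 : t ^ 2 * (n / 2 : ℕ) / (8 * b ^ 2) = 8 * (Real.log p / n) * (n / 2 : ℕ) := by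
      rw [ht, mul_pow, Real.sq_sqrt (by positivity)]
      field_simp
    -- Since `⌊n/2⌋ ≥ n/3`, the exponent is at least `(8/3) log p`. The resulting `p⁻²` absorbs the
    -- union bound over `p` coordinates and leaves `2/p ≤ α`.
    have h2 : 2 * Real.log p ≤ 8 * (Real.log p / n) * (n / 2 : ℕ) := by
      have : 8 * (Real.log p / n) * (n / 3 : ℝ) ≤ 8 * (Real.log p / n) * (n / 2 : ℕ) :=
        mul_le_mul_of_nonneg_left (third_le_half hn) (by positivity)
      have e : 8 * (Real.log p / n) * (n / 3 : ℝ) = 8 / 3 * Real.log p := by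
        field_simp
      linarith
    have h3 : ((p : ℝ) ^ 2)⁻¹ = Real.exp (-(2 * Real.log p)) := by
      rw [Real.exp_neg, two_mul, Real.exp_add, Real.exp_log hp0, sq]
    rw [h1, h3]
    exact Real.exp_le_exp.2 (by linarith)
  have hbad : (((dualSublevel X G w t)ᶜ).card : ℝ) ≤ (Nat.factorial n : ℝ) * α := by
    have hsub : (dualSublevel X G w t)ᶜ ⊆ Finset.univ.biUnion fun j =>
        Finset.univ.filter fun r => t < |rankStatistic (fun i => X i j) r| := by
      intro r hr
      by_contra h
      simp only [Finset.mem_biUnion, Finset.mem_univ, Finset.mem_filter, true_and, not_exists,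
        not_lt] at h
      refine Finset.mem_compl.1 hr ?_
      simp only [dualSublevel, Finset.mem_filter, Finset.mem_univ, true_and]
      exact dualPenalty_le hG hw ht0 fun j => by rw [rankGradient_apply, abs_neg]; exact h j
    calc (((dualSublevel X G w t)ᶜ).card : ℝ)
        ≤ ((∑ j : Fin p, (Finset.univ.filter fun r =>
            t < |rankStatistic (fun i => X i j) r|).card : ℕ) : ℝ) :=
          Nat.cast_le.2 ((Finset.card_le_card hsub).trans Finset.card_biUnion_le)
      _ ≤ ∑ _j : Fin p, (Nat.factorial n : ℝ) * (2 * ((p : ℝ) ^ 2)⁻¹) := by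
          push_cast
          refine Finset.sum_le_sum fun j _ =>
            (card_rankStatistic_gt_le hn hb (fun i => hX i j) ht0).trans ?_
          exact mul_le_mul_of_nonneg_left (mul_le_mul_of_nonneg_left hexp (by norm_num)) hf.le
      _ = (Nat.factorial n : ℝ) * (2 / p) := by
          rw [Finset.sum_const, Finset.card_univ, Fintype.card_fin, nsmul_eq_mul]
          field_simp
      _ ≤ (Nat.factorial n : ℝ) * α := by
          refine mul_le_mul_of_nonneg_left ?_ hf.le
          rw [div_le_iff₀ hp0]
          rw [div_le_iff₀ hα] at hpα
          linarith
  rw [dualGradientCDF_eq, le_div_iff₀ hf]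
  rw [Finset.card_compl, Fintype.card_perm, Fintype.card_fin, Nat.cast_sub] at hbad
  · linarith
  · simpa [Fintype.card_perm] using (dualSublevel X G w t).card_le_univ

end Quantile

/-! ### Uniformity of the ranks of exchangeable errors -/

section Exchangeability

variable {S : Type*} [MeasurableSpace S] {P : Measure S} {n : ℕ}

/-- The errors whose order is compatible with one of the rank vectors in `K`. -/
def compatibleErrors (K : Finset (Equiv.Perm (Fin n))) : Set (Fin n → ℝ) :=
  {e | ∃ r ∈ K, ∀ i j, r i < r j → e i ≤ e j}

lemma measurableSet_compatibleErrors (K : Finset (Equiv.Perm (Fin n))) :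
    MeasurableSet (compatibleErrors K) := by
  have : compatibleErrors K = ⋃ r ∈ K, ⋂ i, ⋂ j, {e : Fin n → ℝ | r i < r j → e i ≤ e j} := by
    ext e; simp [compatibleErrors]
  rw [this]
  refine Finset.measurableSet_biUnion _ fun r _ => MeasurableSet.iInter fun i =>
    MeasurableSet.iInter fun j => ?_
  by_cases h : r i < r j
  · simpa [h] using measurableSet_le (measurable_pi_apply i) (measurable_pi_apply j)
  · simp [h]

lemma map_comp_perm_eq [IsProbabilityMeasure P] {ε : Fin n → S → ℝ} (hm : ∀ i, Measurable (ε i))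
    (hind : iIndepFun ε P) {μ : Measure ℝ} (hμ : ∀ i, P.map (ε i) = μ)
    (π : Equiv.Perm (Fin n)) :
    P.map (fun s i => ε (π i) s) = Measure.pi fun _ => μ := by
  have h := (iIndepFun_iff_map_fun_eq_pi_map (fun i => (hm (π i)).aemeasurable)).1
    (hind.precomp π.injective)
  simpa [hμ] using h

/-- The rank vector of exchangeable errors is uniformly distributed. -/
lemma card_le_measure_compatibleErrors [IsProbabilityMeasure P] {ε : Fin n → S → ℝ}
    (hm : ∀ i, Measurable (ε i)) (hind : iIndepFun ε P) {μ : Measure ℝ}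
    (hμ : ∀ i, P.map (ε i) = μ) (K : Finset (Equiv.Perm (Fin n))) :
    (K.card : ℝ) ≤ (Nat.factorial n : ℝ) *
      P.real {s | (fun i => ε i s) ∈ compatibleErrors K} := by
  classical
  have hmeas : ∀ π : Equiv.Perm (Fin n), Measurable fun s i => ε (π i) s :=
    fun π => measurable_pi_lambda _ fun i => hm (π i)
  set A : Equiv.Perm (Fin n) → Set S := fun π => {s | (fun i => ε (π i) s) ∈ compatibleErrors K}
  have hA : ∀ π, MeasurableSet (A π) := fun π => hmeas π (measurableSet_compatibleErrors K)
  have hPA : ∀ π, P (A π) = P (A 1) := fun π => by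
    have h := fun π => Measure.map_apply (μ := P) (hmeas π) (measurableSet_compatibleErrors K)
    exact (h π).symm.trans ((congrArg (fun ν => ν (compatibleErrors K))
      ((map_comp_perm_eq hm hind hμ π).trans (map_comp_perm_eq hm hind hμ 1).symm)).trans (h 1))
  -- If `σ` sorts the errors, relabelling them by `σ * r` makes them compatible with `r`, and
  -- distinct `r` give distinct relabellings. Ties are harmless, as compatibility asks only for `≤`.
  have hcount : ∀ s, (K.card : ENNReal) ≤ ∑ π, (A π).indicator (fun _ => 1) s := fun s => by
    have h1 : ∑ π, (A π).indicator (fun _ => (1 : ENNReal)) s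
        = ((Finset.univ.filter fun π => s ∈ A π).card : ENNReal) := by
      simp [Set.indicator_apply]
    rw [h1]
    refine Nat.cast_le.2 ?_
    set σ := Tuple.sort fun i => ε i s
    refine Finset.card_le_card_of_injOn (fun r => σ * r) (fun r hr => ?_)
      (fun _ _ _ _ h => mul_left_cancel h)
    simp only [Finset.coe_filter, Finset.mem_univ, true_and, Set.mem_ofPred_eq]
    exact ⟨r, hr, fun i j hij => Tuple.monotone_sort (fun i => ε i s) hij.le⟩
  have h2 : (K.card : ENNReal) ≤ (Nat.factorial n : ENNReal) * P (A 1) :=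
    calc (K.card : ENNReal) = ∫⁻ _, (K.card : ENNReal) ∂P := by simp
      _ ≤ ∫⁻ s, ∑ π, (A π).indicator (fun _ => 1) s ∂P := lintegral_mono hcount
      _ = ∑ π, P (A π) := by
          rw [lintegral_finsetSum _ fun π _ => measurable_const.indicator (hA π)]
          exact Finset.sum_congr rfl fun π _ => by simp [lintegral_indicator (hA π)]
      _ = _ := by simp [hPA, Fintype.card_perm]
  have h3 := ENNReal.toReal_mono (ENNReal.mul_ne_top (ENNReal.natCast_ne_top _)
    (measure_ne_top P _)) h2
  rw [ENNReal.toReal_mul, ENNReal.toReal_natCast, ENNReal.toReal_natCast] at h3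
  exact h3

end Exchangeability

/-! ### Symmetrization and contraction for exponential moments of suprema -/

section ExponentialProcess

variable {ι : Type*} [Fintype ι] [Nonempty ι]

/-- The supremum of the exponentials of finitely many numbers. -/
noncomputable def supExp (v : ι → ℝ) : ℝ :=
  Finset.univ.sup' Finset.univ_nonempty fun i => Real.exp (v i)

lemma exp_le_supExp (v : ι → ℝ) (i : ι) : Real.exp (v i) ≤ supExp v :=
  Finset.le_sup' (fun i => Real.exp (v i)) (Finset.mem_univ i)

lemma supExp_le {v : ι → ℝ} {c : ℝ} (h : ∀ i, Real.exp (v i) ≤ c) : supExp v ≤ c :=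
  Finset.sup'_le _ _ fun i _ => h i

lemma exists_eq_supExp (v : ι → ℝ) : ∃ i, supExp v = Real.exp (v i) := by
  obtain ⟨i, -, h⟩ := Finset.exists_mem_eq_sup' Finset.univ_nonempty fun i => Real.exp (v i)
  exact ⟨i, h⟩

lemma supExp_pos (v : ι → ℝ) : 0 < supExp v := by
  obtain ⟨i, h⟩ := exists_eq_supExp v
  rw [h]
  exact Real.exp_pos _

lemma measurable_supExp {Ω : Type*} [MeasurableSpace Ω] {v : Ω → ι → ℝ}
    (hv : ∀ i, Measurable fun x => v x i) : Measurable fun x => supExp (v x) := by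
  have h := Finset.measurable_sup' (s := (Finset.univ : Finset ι)) Finset.univ_nonempty
    (f := fun i x => Real.exp (v x i)) fun i _ => (hv i).exp
  convert h using 2 with x
  rw [Finset.sup'_apply]
  rfl

lemma integrable_supExp {Ω : Type*} [MeasurableSpace Ω] {μ : Measure Ω} [IsFiniteMeasure μ]
    {v : Ω → ι → ℝ} (hv : ∀ i, Measurable fun x => v x i) {C : ι → ℝ}
    (hC : ∀ x i, v x i ≤ C i) : Integrable (fun x => supExp (v x)) μ := by
  refine Integrable.of_bound (measurable_supExp hv).aestronglyMeasurable (supExp C)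
    (Filter.Eventually.of_forall fun x => ?_)
  rw [Real.norm_eq_abs, abs_of_pos (supExp_pos _)]
  exact supExp_le fun i => (Real.exp_le_exp.2 (hC x i)).trans (exp_le_supExp C i)

/-- Weak majorization of two-term sums of exponentials. -/
lemma exp_add_exp_le {P Q x y : ℝ} (h1 : P ≤ max x y) (h2 : Q ≤ max x y) (h3 : P + Q ≤ x + y) :
    Real.exp P + Real.exp Q ≤ Real.exp x + Real.exp y := by
  have key : ∀ {P Q x y : ℝ}, P ≤ x → Q ≤ x → P + Q ≤ x + y →
      Real.exp P + Real.exp Q ≤ Real.exp x + Real.exp y := by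
    intro P Q x y h1 h2 h3
    have e1 : Real.exp (P + Q - x) ≤ Real.exp y := Real.exp_le_exp.2 (by linarith)
    have e2 : 0 ≤ (Real.exp x - Real.exp P) * (1 - Real.exp (Q - x)) :=
      mul_nonneg (sub_nonneg.2 (Real.exp_le_exp.2 h1))
        (sub_nonneg.2 (Real.exp_le_one_iff.2 (by linarith)))
    have e3 : Real.exp x * Real.exp (Q - x) = Real.exp Q := by rw [← Real.exp_add]; ring_nf
    have e4 : Real.exp P * Real.exp (Q - x) = Real.exp (P + Q - x) := by
      rw [← Real.exp_add]; ring_nf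
    have e5 : (Real.exp x - Real.exp P) * (1 - Real.exp (Q - x))
        = Real.exp x - Real.exp P - Real.exp x * Real.exp (Q - x)
          + Real.exp P * Real.exp (Q - x) := by ring
    linarith
  rcases le_total y x with h | h
  · rw [max_eq_left h] at h1 h2
    exact key h1 h2 h3
  · rw [max_eq_right h] at h1 h2
    rw [add_comm (Real.exp x)]
    exact key h1 h2 (by linarith)

/-- The one-coordinate contraction principle for exponentials of suprema. -/
lemma supExp_contraction {a δ t : ι → ℝ} (h1 : ∀ i, |δ i| ≤ |t i|)
    (h2 : ∀ i j, |δ i - δ j| ≤ |t i - t j|) :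
    supExp (fun i => a i + δ i) + supExp (fun i => a i - δ i)
      ≤ supExp (fun i => a i + t i) + supExp (fun i => a i - t i) := by
  obtain ⟨i, hi⟩ := exists_eq_supExp fun i => a i + δ i
  obtain ⟨j, hj⟩ := exists_eq_supExp fun i => a i - δ i
  obtain ⟨k, hk⟩ := exists_eq_supExp fun i => a i + t i
  obtain ⟨l, hl⟩ := exists_eq_supExp fun i => a i - t i
  have hx : ∀ i, a i + t i ≤ a k + t k := fun i =>
    Real.exp_le_exp.1 (hk ▸ exp_le_supExp (fun i => a i + t i) i)
  have hy : ∀ i, a i - t i ≤ a l - t l := fun i =>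
    Real.exp_le_exp.1 (hl ▸ exp_le_supExp (fun i => a i - t i) i)
  rw [hi, hj, hk, hl]
  have hm : ∀ i, a i + |t i| ≤ max (a k + t k) (a l - t l) := fun i => by
    rcases abs_cases (t i) with h | h
    · rw [h.1]; exact le_max_of_le_left (hx i)
    · rw [h.1]; exact le_max_of_le_right (hy i)
  refine exp_add_exp_le ?_ ?_ ?_
  · have := (le_abs_self _).trans (h1 i)
    linarith [hm i]
  · have := (neg_le_abs _).trans (h1 j)
    linarith [hm j]
  -- The maximizers `i` and `j` are compared with opposite signs of `t`: `i` with `+t` when `t i ≥ t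
  -- j`, and with `-t` otherwise.
  · have h := (le_abs_self _).trans (h2 i j)
    rcases abs_cases (t i - t j) with h' | h' <;> rw [h'.1] at h
    · linarith [hx i, hy j]
    · linarith [hx j, hy i]

variable {Z : Type*} [MeasurableSpace Z] {ν : Measure Z} [IsProbabilityMeasure ν]

lemma abs_integral_le_of_abs_le {f : Z → ℝ} {C : ℝ} (h : ∀ z, |f z| ≤ C) : |∫ z, f z ∂ν| ≤ C := by
  have := norm_integral_le_of_norm_le_const (μ := ν)
    (Filter.Eventually.of_forall fun z => (Real.norm_eq_abs (f z)).le.trans (h z))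
  simpa using this

/-- Symmetrization and contraction for one coordinate of a centered process. -/
lemma integral_supExp_centered_le {f : Z → ι → ℝ} (hf : ∀ i, Measurable fun z => f z i)
    {a t : ι → ℝ} (h1 : ∀ z i, |f z i| ≤ |t i| / 2)
    (h2 : ∀ z i j, |f z i - f z j| ≤ |t i - t j| / 2) :
    ∫ z, supExp (fun i => a i + (∫ z', f z' i ∂ν - f z i)) ∂ν
      ≤ (supExp (fun i => a i + t i) + supExp (fun i => a i - t i)) / 2 := by
  set B := supExp (fun i => a i + t i) + supExp (fun i => a i - t i) with hB
  set H : Z → Z → ℝ := fun z z' => supExp fun i => a i + (f z' i - f z i) with hH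
  have hfi : ∀ i, Integrable (fun z => f z i) ν := fun i =>
    Integrable.of_bound (hf i).aestronglyMeasurable (|t i| / 2)
      (Filter.Eventually.of_forall fun z => h1 z i)
  have hbd : ∀ z z' i, a i + (f z' i - f z i) ≤ a i + |t i| := fun z z' i => by
    have e1 := (le_abs_self _).trans (h1 z' i)
    have e2 := (neg_le_abs _).trans (h1 z i)
    linarith
  have hHint : Integrable (fun q : Z × Z => H q.1 q.2) (ν.prod ν) :=
    integrable_supExp (fun i => measurable_const.add
      (((hf i).comp measurable_snd).sub ((hf i).comp measurable_fst))) fun q i => hbd _ _ i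
  have hHz : ∀ z, Integrable (H z) ν := fun z =>
    integrable_supExp (fun i => measurable_const.add ((hf i).sub measurable_const))
      fun z' i => hbd z z' i
  -- Jensen moves the mean over an independent copy `z'` outside the exponential and the supremum.
  have hpt : ∀ z, supExp (fun i => a i + (∫ z', f z' i ∂ν - f z i)) ≤ ∫ z', H z z' ∂ν := by
    intro z
    refine supExp_le fun i => ?_
    have hint : Integrable (fun z' => a i + (f z' i - f z i)) ν :=
      (integrable_const _).add ((hfi i).sub (integrable_const _))
    have hexp : Integrable (fun z' => Real.exp (a i + (f z' i - f z i))) ν := by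
      refine Integrable.of_bound (measurable_const.add ((hf i).sub measurable_const)).exp.aestronglyMeasurable
        (Real.exp (a i + |t i|)) (Filter.Eventually.of_forall fun z' => ?_)
      rw [Real.norm_eq_abs, Real.abs_exp]
      exact Real.exp_le_exp.2 (hbd z z' i)
    have e : a i + (∫ z', f z' i ∂ν - f z i) = ∫ z', (a i + (f z' i - f z i)) ∂ν := by
      have e1 := integral_add (μ := ν) (f := fun _ => a i) (g := fun z' => f z' i - f z i)
        (integrable_const _) ((hfi i).sub (integrable_const _))
      have e2 := integral_sub (μ := ν) (f := fun z' => f z' i) (g := fun _ => f z i) (hfi i)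
        (integrable_const _)
      rw [e1, e2]
      simp
    rw [e]
    refine (convexOn_exp.map_integral_le Real.continuous_exp.continuousOn isClosed_univ
      (Filter.Eventually.of_forall fun _ => Set.mem_univ _) hint hexp).trans ?_
    exact integral_mono hexp (hHz z) fun z' => exp_le_supExp (fun i => a i + (f z' i - f z i)) i
  have hI : ∫ z, supExp (fun i => a i + (∫ z', f z' i ∂ν - f z i)) ∂ν
      ≤ ∫ z, ∫ z', H z z' ∂ν ∂ν := by
    refine integral_mono (integrable_supExp (C := fun i => a i + |t i|)
      (fun i => measurable_const.add (measurable_const.sub (hf i))) fun z i => ?_)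
      hHint.integral_prod_left hpt
    have e1 := (le_abs_self _).trans (abs_integral_le_of_abs_le (ν := ν) fun z => h1 z i)
    have e2 := (neg_le_abs _).trans (h1 z i)
    linarith
  have hswap : ∫ z, ∫ z', H z z' ∂ν ∂ν = ∫ z, ∫ z', H z' z ∂ν ∂ν :=
    integral_integral_swap hHint
  -- Exchanging `z` and `z'` changes the sign of the increment, so contraction applies pointwise to
  -- the sum of both orders, without random signs.
  have hsum : ∫ z, ∫ z', H z z' ∂ν ∂ν + ∫ z, ∫ z', H z' z ∂ν ∂ν ≤ B := by
    have hHint' : Integrable (fun q : Z × Z => H q.2 q.1) (ν.prod ν) := hHint.swap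
    rw [← integral_add hHint.integral_prod_left hHint'.integral_prod_left]
    have hz : ∀ z, ∫ z', H z z' ∂ν + ∫ z', H z' z ∂ν ≤ B := fun z => by
      have hHz' : Integrable (fun z' => H z' z) ν :=
        integrable_supExp (fun i => measurable_const.add (measurable_const.sub (hf i)))
          fun z' i => hbd z' z i
      rw [← integral_add (hHz z) hHz']
      refine (integral_mono ((hHz z).add hHz') (integrable_const B) fun z' => ?_).trans
        (le_of_eq (by simp))
      have e : H z' z = supExp fun i => a i - (f z' i - f z i) := by
        simp only [hH]
        congr 1
        ext i
        ring
      simp only [Pi.add_apply]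
      rw [e]
      refine supExp_contraction (fun i => ?_) fun i j => ?_
      · refine (abs_sub _ _).trans ?_
        linarith [h1 z i, h1 z' i]
      · have : f z' i - f z i - (f z' j - f z j) = (f z' i - f z' j) - (f z i - f z j) := by ring
        rw [this]
        refine (abs_sub _ _).trans ?_
        linarith [h2 z i j, h2 z' i j]
    refine (integral_mono (hHint.integral_prod_left.add hHint'.integral_prod_left)
      (integrable_const B) hz).trans (le_of_eq (by simp))
  linarith

/-- On an `ℓ₁` ball a linear form is largest at a vertex `±M eⱼ`; the maximum over vertices is
bounded by their sum. -/
lemma supExp_linear_le {p : ℕ} (hp : 0 < p) {γ : ι → Fin p → ℝ} {M : ℝ}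
    (hγ : ∀ i, ∑ j, |γ i j| ≤ M) (b : Fin p → ℝ) :
    supExp (fun i => ∑ j, b j * γ i j) ≤ ∑ j, (Real.exp (M * b j) + Real.exp (-(M * b j))) := by
  have : Nonempty (Fin p) := ⟨⟨0, hp⟩⟩
  obtain ⟨j₀, hj₀⟩ := Finite.exists_max fun j => |b j|
  refine supExp_le fun i => ?_
  have h1 : ∑ j, b j * γ i j ≤ M * |b j₀| :=
    calc ∑ j, b j * γ i j ≤ ∑ j, |γ i j| * |b j₀| := Finset.sum_le_sum fun j _ => by
          refine (le_abs_self _).trans ?_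
          rw [abs_mul, mul_comm]
          exact mul_le_mul_of_nonneg_left (hj₀ j) (abs_nonneg _)
      _ = (∑ j, |γ i j|) * |b j₀| := by rw [Finset.sum_mul]
      _ ≤ M * |b j₀| := mul_le_mul_of_nonneg_right (hγ i) (abs_nonneg _)
  have h2 : Real.exp (M * |b j₀|) ≤ Real.exp (M * b j₀) + Real.exp (-(M * b j₀)) := by
    rcases abs_cases (b j₀) with h | h
    · rw [h.1]; linarith [Real.exp_pos (-(M * b j₀))]
    · rw [h.1, mul_neg]; linarith [Real.exp_pos (M * b j₀)]
  refine (Real.exp_le_exp.2 h1).trans (h2.trans ?_)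
  exact Finset.single_le_sum (f := fun j => Real.exp (M * b j) + Real.exp (-(M * b j)))
    (fun j _ => by positivity) (Finset.mem_univ j₀)

/-- Exponential moment bound for the supremum of a centered empirical process whose summands are
Lipschitz functions of linear forms with coefficient vectors of bounded `ℓ₁` norm. -/
lemma integral_pi_supExp_le {p : ℕ} (hp : 0 < p) {γ : ι → Fin p → ℝ} {M : ℝ}
    (hγ : ∀ i, ∑ j, |γ i j| ≤ M) :
    ∀ {m : ℕ} (x : Fin m → Fin p → ℝ) (f : Fin m → Z → ι → ℝ)
      (_ : ∀ k i, Measurable fun z => f k z i)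
      (_ : ∀ k z i, |f k z i| ≤ |∑ j, x k j * γ i j| / 2)
      (_ : ∀ k z i i', |f k z i - f k z i'|
        ≤ |∑ j, x k j * γ i j - ∑ j, x k j * γ i' j| / 2) (b : Fin p → ℝ),
      ∫ z : Fin m → Z, supExp (fun i => ∑ j, b j * γ i j
          + ∑ k, (∫ z', f k z' i ∂ν - f k (z k) i)) ∂(Measure.pi fun _ => ν)
        ≤ ∑ j, (Real.exp (M * b j) + Real.exp (-(M * b j))) * ∏ k, Real.cosh (M * x k j) := by
  intro m
  induction m with
  | zero =>
    intro x f _ _ _ b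
    simpa using supExp_linear_le hp hγ b
  | succ m ih =>
    intro x f hf h1 h2 b
    set F : Z × (Fin m → Z) → ℝ := fun q => supExp fun i =>
      (∑ j, b j * γ i j + ∑ k : Fin m, (∫ z', f k.succ z' i ∂ν - f k.succ (q.2 k) i))
        + (∫ z', f 0 z' i ∂ν - f 0 q.1 i) with hF
    have hcen : ∀ k z i, ∫ z', f k z' i ∂ν - f k z i ≤ |∑ j, x k j * γ i j| := fun k z i => by
      have e1 := (le_abs_self _).trans (abs_integral_le_of_abs_le (ν := ν) fun z => h1 k z i)
      have e2 := (neg_le_abs _).trans (h1 k z i)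
      linarith
    have hFint : Integrable F (ν.prod (Measure.pi fun _ => ν)) := by
      refine integrable_supExp (C := fun i => (∑ j, b j * γ i j
        + ∑ k : Fin m, |∑ j, x k.succ j * γ i j|) + |∑ j, x 0 j * γ i j|) (fun i => ?_)
        fun q i => ?_
      · refine (measurable_const.add (Finset.measurable_sum _ fun k _ => ?_)).add ?_
        · exact measurable_const.sub ((hf k.succ i).comp
            ((measurable_pi_apply k).comp measurable_snd))
        · exact measurable_const.sub ((hf 0 i).comp measurable_fst)
      · refine add_le_add (add_le_add le_rfl (Finset.sum_le_sum fun k _ => ?_)) (hcen 0 q.1 i)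
        exact hcen k.succ (q.2 k) i
    have e1 : ∫ z : Fin (m + 1) → Z, supExp (fun i => ∑ j, b j * γ i j
          + ∑ k, (∫ z', f k z' i ∂ν - f k (z k) i)) ∂(Measure.pi fun _ => ν)
        = ∫ q, F q ∂(ν.prod (Measure.pi fun _ => ν)) := by
      rw [← (measurePreserving_piFinSuccAbove (fun _ : Fin (m + 1) => ν) 0).integral_comp']
      congr 1
      ext z
      simp only [hF]
      congr 1
      ext i
      rw [Fin.sum_univ_succ]
      simp [MeasurableEquiv.piFinSuccAbove, Fin.tail]
      ring
    -- With the other coordinates fixed, the first one becomes `±` a linear form and is absorbed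
    -- into `b`; this is why the induction runs over all `b`.
    have inner : ∀ z' : Fin m → Z, ∫ z, F (z, z') ∂ν ≤
        (supExp (fun i => ∑ j, (b j + x 0 j) * γ i j
            + ∑ k : Fin m, (∫ z', f k.succ z' i ∂ν - f k.succ (z' k) i))
          + supExp (fun i => ∑ j, (b j - x 0 j) * γ i j
            + ∑ k : Fin m, (∫ z', f k.succ z' i ∂ν - f k.succ (z' k) i))) / 2 := fun z' => by
      refine (integral_supExp_centered_le (ν := ν) (f := f 0) (a := fun i => ∑ j, b j * γ i j
        + ∑ k : Fin m, (∫ z', f k.succ z' i ∂ν - f k.succ (z' k) i)) (t := fun i => ∑ j, x 0 j * γ i j) (hf 0) (h1 0)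
        (h2 0)).trans (le_of_eq ?_)
      congr 3 <;> ext i <;> simp only [add_mul, sub_mul, Finset.sum_add_distrib,
        Finset.sum_sub_distrib] <;> ring
    have hGint : ∀ b' : Fin p → ℝ, Integrable (fun z' : Fin m → Z =>
        supExp (fun i => ∑ j, b' j * γ i j
          + ∑ k : Fin m, (∫ z', f k.succ z' i ∂ν - f k.succ (z' k) i)))
        (Measure.pi fun _ => ν) := fun b' => by
      refine integrable_supExp (C := fun i => ∑ j, b' j * γ i j
        + ∑ k : Fin m, |∑ j, x k.succ j * γ i j|) (fun i => ?_) fun q i => ?_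
      · refine measurable_const.add (Finset.measurable_sum _ fun k _ => ?_)
        exact measurable_const.sub ((hf k.succ i).comp (measurable_pi_apply k))
      · exact add_le_add le_rfl (Finset.sum_le_sum fun k _ => hcen k.succ (q k) i)
    rw [e1, integral_prod_symm _ hFint]
    refine (integral_mono hFint.integral_prod_right
      (((hGint fun j => b j + x 0 j).add (hGint fun j => b j - x 0 j)).div_const 2) inner).trans ?_
    rw [integral_div]
    simp only [Pi.add_apply]
    rw [integral_add (hGint _) (hGint _)]
    have i1 := ih (fun k => x k.succ) (fun k => f k.succ) (fun k => hf k.succ)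
      (fun k => h1 k.succ) (fun k => h2 k.succ) fun j => b j + x 0 j
    have i2 := ih (fun k => x k.succ) (fun k => f k.succ) (fun k => hf k.succ)
      (fun k => h1 k.succ) (fun k => h2 k.succ) fun j => b j - x 0 j
    refine (div_le_div_of_nonneg_right (add_le_add i1 i2) (by norm_num)).trans (le_of_eq ?_)
    rw [← Finset.sum_add_distrib, Finset.sum_div]
    refine Finset.sum_congr rfl fun j _ => ?_
    rw [Fin.prod_univ_succ, Real.cosh_eq (M * x 0 j)]
    simp only [mul_add, mul_sub, neg_add, neg_sub, Real.exp_add, Real.exp_sub, Real.exp_neg]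
    have := Real.exp_pos (M * x 0 j)
    have := Real.exp_pos (M * b j)
    field_simp
    ring

end ExponentialProcess

/-! ### Independence of differences over disjoint pairs -/

section PairDifferences

variable {S : Type*} [MeasurableSpace S] {P : Measure S} [IsProbabilityMeasure P] {n : ℕ}

/-- A product measure over a sum of index sets is the product of the products over the fibres. It
groups the errors into independent pairs. -/
lemma iIndepFun_curry {κ τ : Type*} {Y : κ → τ → S → ℝ} (hY : ∀ i j, Measurable (Y i j))
    (h : iIndepFun (fun (q : (_ : κ) × τ) s => Y q.1 q.2 s) P) :
    iIndepFun (fun i s j => Y i j s) P := by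
  have hpr : ∀ i j, IsProbabilityMeasure (P.map (Y i j)) :=
    fun i j => Measure.isProbabilityMeasure_map (hY i j).aemeasurable
  rw [iIndepFun_iff_map_fun_eq_infinitePi_map (by fun_prop)] at h ⊢
  have h1 : ∀ i, P.map (fun s j => Y i j s) = Measure.infinitePi fun j => P.map (Y i j) := by
    intro i
    have h0 := (iIndepFun_iff_map_fun_eq_infinitePi_map (X := fun (q : (_ : κ) × τ) s =>
      Y q.1 q.2 s) (by fun_prop)).2 h
    exact (iIndepFun_iff_map_fun_eq_infinitePi_map (fun j => hY i j)).1
      (h0.precomp (g := fun j => (⟨i, j⟩ : (_ : κ) × τ)) fun a b hab => by simpa using hab)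
  simp only [h1]
  rw [← Measure.infinitePi_map_piCurry (fun i j => P.map (Y i j)), ← h,
    Measure.map_map (by fun_prop) (by fun_prop)]
  rfl

/-- The differences of independent errors over disjoint pairs are independent. -/
lemma map_pairDifference_eq_pi {ε : Fin n → S → ℝ} (hm : ∀ i, Measurable (ε i))
    (hind : iIndepFun ε P) {ν : Measure ℝ}
    (hν : ∀ i j, i ≠ j → P.map (fun s => ε i s - ε j s) = ν) (π : Equiv.Perm (Fin n)) :
    P.map (fun s (k : Fin (n / 2)) => ε (π (pairFst k)) s - ε (π (pairSnd k)) s)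
      = Measure.pi fun _ => ν := by
  set idx : (_ : Fin (n / 2)) × Bool → Fin n := fun q =>
    if q.2 then π (pairFst q.1) else π (pairSnd q.1) with hidx
  have hinj : Function.Injective idx := by
    rintro ⟨k, a⟩ ⟨l, b⟩ h
    cases a <;> cases b <;> simp only [hidx, if_true, Bool.false_eq_true, if_false,
      EmbeddingLike.apply_eq_iff_eq] at h
    · rw [pairSnd_injective h]
    · exact absurd h.symm (pairFst_ne_pairSnd _ _)
    · exact absurd h (pairFst_ne_pairSnd _ _)
    · rw [pairFst_injective h]
  have h1 : iIndepFun (fun (k : Fin (n / 2)) s (c : Bool) => ε (idx ⟨k, c⟩) s) P :=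
    iIndepFun_curry (Y := fun k c => ε (idx ⟨k, c⟩)) (fun _ _ => hm _) (hind.precomp hinj)
  have h2 := h1.comp (fun _ (y : Bool → ℝ) => y true - y false)
    fun _ => (measurable_pi_apply _).sub (measurable_pi_apply _)
  have h3 := (iIndepFun_iff_map_fun_eq_pi_map (fun k => ((hm (π (pairFst k))).sub
    (hm (π (pairSnd k)))).aemeasurable)).1 h2
  refine h3.trans ?_
  congr 1
  ext1 k
  exact hν _ _ (π.injective.ne (pairFst_ne_pairSnd k k))

end PairDifferences

/-! ### Quadratic growth of the expected loss -/

section Curvature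

/-- The change of the absolute loss at `z` when the location is shifted by `d`. -/
def shiftLoss (z d : ℝ) : ℝ := |z - d| - |z|

lemma abs_shiftLoss_le (z d : ℝ) : |shiftLoss z d| ≤ |d| := by
  unfold shiftLoss
  have := abs_abs_sub_abs_le_abs_sub (z - d) z
  simpa using this

lemma abs_shiftLoss_sub_le (z d d' : ℝ) : |shiftLoss z d - shiftLoss z d'| ≤ |d - d'| := by
  unfold shiftLoss
  have := abs_abs_sub_abs_le_abs_sub (z - d) (z - d')
  rw [abs_sub_comm d d']
  refine le_trans (le_of_eq ?_) (this.trans (le_of_eq ?_)) <;> congr 1 <;> ring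

lemma measurable_shiftLoss (d : ℝ) : Measurable fun z => shiftLoss z d := by
  unfold shiftLoss
  fun_prop

lemma integrable_shiftLoss {ν : Measure ℝ} [IsFiniteMeasure ν] (d : ℝ) :
    Integrable (fun z => shiftLoss z d) ν :=
  Integrable.of_bound (measurable_shiftLoss d).aestronglyMeasurable |d|
    (Filter.Eventually.of_forall fun z => abs_shiftLoss_le z d)

lemma integral_tent {D : ℝ} (hD : 0 ≤ D) : ∫ z in Set.Icc (-D) D, (D - |z|) = D ^ 2 := by
  rw [integral_Icc_eq_integral_Ioc, ← intervalIntegral.integral_of_le (by linarith)]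
  have hi : ∀ a b : ℝ, IntervalIntegrable (fun z : ℝ => D - |z|) volume a b := fun a b =>
    (by fun_prop : Continuous fun z : ℝ => D - |z|).intervalIntegrable a b
  rw [← intervalIntegral.integral_add_adjacent_intervals (hi (-D) 0) (hi 0 D)]
  have h1 : ∫ z in (-D)..0, (D - |z|) = ∫ z in (-D)..0, (D + z) := by
    refine intervalIntegral.integral_congr fun z hz => ?_
    rw [Set.uIcc_of_le (by linarith)] at hz
    simp only [abs_of_nonpos hz.2]
    ring
  have h2 : ∫ z in (0)..D, (D - |z|) = ∫ z in (0)..D, (D - z) := by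
    refine intervalIntegral.integral_congr fun z hz => ?_
    rw [Set.uIcc_of_le hD] at hz
    simp only [abs_of_nonneg hz.1]
  rw [h1, h2, intervalIntegral.integral_add (by simp) (by simp),
    intervalIntegral.integral_sub (by simp) (by simp)]
  simp
  ring

lemma smul_restrict_le_withDensity {f : ℝ → ℝ} {b D : ℝ}
    (hf : ∀ z, |z| ≤ D → b ≤ f z) :
    ENNReal.ofReal b • (volume.restrict (Set.Icc (-D) D))
      ≤ (volume : Measure ℝ).withDensity fun z => ENNReal.ofReal (f z) := by
  refine Measure.le_iff.2 fun s hs => ?_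
  rw [Measure.smul_apply, Measure.restrict_apply hs, withDensity_apply _ hs, smul_eq_mul,
    ← setLIntegral_const]
  refine (setLIntegral_mono' (hs.inter measurableSet_Icc) fun z hz => ?_).trans
    (lintegral_mono_set Set.inter_subset_left)
  exact ENNReal.ofReal_le_ofReal (hf z (abs_le.2 hz.2))

/-- Quadratic lower bound for the expected increase of the absolute loss of a symmetric variable
whose density is bounded below near the origin. -/
lemma le_integral_shiftLoss {ν : Measure ℝ} [IsProbabilityMeasure ν]
    (hsymm : ν.map (fun z => -z) = ν) {f : ℝ → ℝ} {b R d : ℝ} (hb : 0 < b)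
    (hν : ν = volume.withDensity fun z => ENNReal.ofReal (f z)) (hf : ∀ z, |z| ≤ R → b ≤ f z)
    (hd : |d| ≤ R) : b * d ^ 2 ≤ ∫ z, shiftLoss z d ∂ν := by
  have h1 : ∫ z, shiftLoss z d ∂ν = ∫ z, shiftLoss (-z) d ∂ν := by
    conv_lhs => rw [← hsymm]
    exact integral_map measurable_neg.aemeasurable (measurable_shiftLoss d).aestronglyMeasurable
  have hint2 : Integrable (fun z => shiftLoss (-z) d) ν :=
    Integrable.of_bound ((measurable_shiftLoss d).comp measurable_neg).aestronglyMeasurable |d|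
      (Filter.Eventually.of_forall fun z => abs_shiftLoss_le (-z) d)
  set g : ℝ → ℝ := fun z => max (|d| - |z|) 0 with hg
  have hgm : Measurable g := by simp only [hg]; fun_prop
  have hgint : Integrable g ν := by
    refine Integrable.of_bound hgm.aestronglyMeasurable |d| (Filter.Eventually.of_forall fun z => ?_)
    rw [Real.norm_eq_abs, abs_of_nonneg (le_max_right _ _)]
    exact max_le (by linarith [abs_nonneg z]) (abs_nonneg d)
  -- By symmetry `z` may be averaged with `-z`, and `|z - d| + |z + d| - 2|z| = 2 max (|d| - |z|)
  -- 0`, twice a tent of area `d²`.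
  have h2 : 2 * ∫ z, shiftLoss z d ∂ν = 2 * ∫ z, g z ∂ν := by
    have e := integral_add (integrable_shiftLoss (ν := ν) d) hint2
    rw [← h1] at e
    rw [two_mul, ← e, ← integral_const_mul]
    congr 1
    ext z
    simp only [shiftLoss, hg]
    rcases abs_cases d with h | h <;> rcases abs_cases z with h' | h' <;>
      rcases abs_cases (z - d) with h3 | h3 <;> rcases abs_cases (-z - d) with h4 | h4 <;>
      rcases max_cases (|d| - |z|) 0 with h5 | h5 <;> rw [abs_neg] <;> linarith
  have h3 : ∫ z, g z ∂ν = ∫ z, shiftLoss z d ∂ν := by linarith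
  rw [← h3]
  have hle := smul_restrict_le_withDensity (b := b) (D := |d|) fun z hz => hf z (hz.trans hd)
  rw [← hν] at hle
  refine le_trans (le_of_eq ?_)
    (integral_mono_measure hle (Filter.Eventually.of_forall fun z => le_max_right _ _) hgint)
  rw [integral_smul_measure, ENNReal.toReal_ofReal hb.le, smul_eq_mul]
  congr 1
  rw [← sq_abs, ← integral_tent (abs_nonneg d)]
  refine setIntegral_congr_fun measurableSet_Icc fun z hz => ?_
  simp only [hg]
  rw [max_eq_left (by linarith [abs_le.2 hz])]

lemma sum_sum_sq_sub {n : ℕ} {v : Fin n → ℝ} (hv : ∑ i, v i = 0) :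
    ∑ i, ∑ j, (v i - v j) ^ 2 = 2 * n * ∑ i, v i ^ 2 := by
  have : ∀ i j, (v i - v j) ^ 2 = v i ^ 2 - 2 * v i * v j + v j ^ 2 := fun i j => by ring
  simp only [this, Finset.sum_add_distrib, Finset.sum_sub_distrib, ← Finset.mul_sum, hv]
  simp only [mul_zero, Finset.sum_const_zero, Finset.sum_const, Finset.card_univ,
    Fintype.card_fin, nsmul_eq_mul, ← Finset.mul_sum]
  ring

variable {n p : ℕ}

/-- The expected increase of the rank loss when the residuals, whose differences have law `ν`, are
shifted by `v`. -/
noncomputable def expectedLoss (ν : Measure ℝ) (v : Fin n → ℝ) : ℝ :=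
  1 / ((n : ℝ) * ((n : ℝ) - 1)) *
    ∑ i, ∑ j ∈ Finset.univ.erase i, ∫ z, shiftLoss z (v i - v j) ∂ν

lemma rankLoss_sub_rankLoss (v e : Fin n → ℝ) :
    rankLoss (v - e) - rankLoss (-e) = 1 / ((n : ℝ) * ((n : ℝ) - 1)) *
      ∑ i, ∑ j ∈ Finset.univ.erase i, shiftLoss (e i - e j) (v i - v j) := by
  unfold rankLoss
  rw [← mul_sub, ← Finset.sum_sub_distrib]
  congr 1
  refine Finset.sum_congr rfl fun i _ => ?_
  rw [← Finset.sum_sub_distrib]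
  refine Finset.sum_congr rfl fun j _ => ?_
  simp only [shiftLoss, Pi.sub_apply, Pi.neg_apply]
  rw [abs_sub_comm (e i - e j), abs_sub_comm (e i)]
  congr 2 <;> ring

/-- For a centered vector the squared pair differences sum to `2n ∑ vᵢ²`. The bound `R` keeps each
difference in the range where the quadratic lower bound holds. -/
lemma le_expectedLoss (hn : 2 ≤ n) {ν : Measure ℝ} [IsProbabilityMeasure ν] {b R : ℝ}
    (hb : 0 ≤ b) (hν : ∀ d, |d| ≤ R → b * d ^ 2 ≤ ∫ z, shiftLoss z d ∂ν) {v : Fin n → ℝ}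
    (hv : ∑ i, v i = 0) (hR : ∀ i j, |v i - v j| ≤ R) :
    2 * b / n * ∑ i, v i ^ 2 ≤ expectedLoss ν v := by
  have hn' : (2 : ℝ) ≤ n := by exact_mod_cast hn
  have h1 : b * ∑ i, ∑ j, (v i - v j) ^ 2
      ≤ ∑ i, ∑ j ∈ Finset.univ.erase i, ∫ z, shiftLoss z (v i - v j) ∂ν := by
    rw [Finset.mul_sum]
    refine Finset.sum_le_sum fun i _ => ?_
    rw [← Finset.sum_erase_add _ _ (Finset.mem_univ i), sub_self, zero_pow two_ne_zero, add_zero,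
      Finset.mul_sum]
    exact Finset.sum_le_sum fun j _ => hν _ (hR i j)
  rw [sum_sum_sq_sub hv] at h1
  have h2 := mul_le_mul_of_nonneg_left h1 (pairWeight_nonneg (n := n))
  refine le_trans ?_ h2
  have hs : 0 ≤ ∑ i, v i ^ 2 := Finset.sum_nonneg fun i _ => sq_nonneg _
  have e : 1 / ((n : ℝ) * ((n : ℝ) - 1)) * (b * (2 * n * ∑ i, v i ^ 2))
      = 2 * b / ((n : ℝ) - 1) * ∑ i, v i ^ 2 := by
    have : (n : ℝ) - 1 ≠ 0 := by linarith
    field_simp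
  rw [e]
  refine mul_le_mul_of_nonneg_right ?_ hs
  exact div_le_div_of_nonneg_left (by positivity) (by linarith) (by linarith)

end Curvature

/-! ### Uniform deviations over finitely many directions -/

section Deviation

variable {S : Type*} [MeasurableSpace S] {P : Measure S} [IsProbabilityMeasure P] {n p : ℕ}
variable {ι : Type*} [Fintype ι] [Nonempty ι]

lemma mulVec_sub_mulVec (X : Matrix (Fin n) (Fin p) ℝ) (γ : Fin p → ℝ) (i j : Fin n) :
    (X *ᵥ γ) i - (X *ᵥ γ) j = ∑ l, (X i l - X j l) * γ l := by
  simp only [mulVec, dotProduct, ← Finset.sum_sub_distrib, sub_mul]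

/-- Exponential moments of the supremum of the centered rank loss. -/
lemma integral_supExp_deviation_le (hn : 2 ≤ n) (hp : 0 < p) {ε : Fin n → S → ℝ}
    (hm : ∀ i, Measurable (ε i)) (hind : iIndepFun ε P) {ν : Measure ℝ} [IsProbabilityMeasure ν]
    (hν : ∀ i j, i ≠ j → P.map (fun s => ε i s - ε j s) = ν) {X : Matrix (Fin n) (Fin p) ℝ}
    {b M : ℝ} (hX : ∀ i j, |X i j| ≤ b) {γ : ι → Fin p → ℝ} (hM : 0 ≤ M)
    (hγ : ∀ i, ∑ j, |γ i j| ≤ M) {lam : ℝ} (hlam : 0 ≤ lam) :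
    ∫ s, supExp (fun i => lam * (expectedLoss ν (X *ᵥ γ i)
        - (rankLoss (X *ᵥ γ i - fun l => ε l s) - rankLoss (-fun l => ε l s)))) ∂P
      ≤ 2 * p * Real.exp (8 * M ^ 2 * lam ^ 2 * b ^ 2 / (n / 2 : ℕ)) := by
  have hmpos : (0 : ℝ) < (n / 2 : ℕ) := by
    have : 0 < n / 2 := by omega
    exact_mod_cast this
  set m : ℝ := ((n / 2 : ℕ) : ℝ) with hm_def
  have hf : (0 : ℝ) < (Nat.factorial n : ℝ) := by exact_mod_cast Nat.factorial_pos n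
  have hb : ∀ i : Fin n, 0 ≤ b := fun i => (abs_nonneg _).trans (hX i ⟨0, hp⟩)
  set c : ℝ := lam / m with hc
  have hc0 : 0 ≤ c := by positivity
  set d : Equiv.Perm (Fin n) → Fin (n / 2) → ι → ℝ := fun π k i =>
    (X *ᵥ γ i) (π (pairFst k)) - (X *ᵥ γ i) (π (pairSnd k)) with hd
  -- The factor `2` compensates the halves in the hypotheses of `integral_pi_supExp_le`.
  set x : Equiv.Perm (Fin n) → Fin (n / 2) → Fin p → ℝ := fun π k j =>
    2 * c * (X (π (pairFst k)) j - X (π (pairSnd k)) j) with hx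
  have hxd : ∀ π k i, ∑ j, x π k j * γ i j = 2 * (c * d π k i) := fun π k i => by
    simp only [hx, hd]
    rw [mulVec_sub_mulVec, Finset.mul_sum, Finset.mul_sum]
    exact Finset.sum_congr rfl fun j _ => by ring
  set Y : Equiv.Perm (Fin n) → S → Fin (n / 2) → ℝ := fun π s k =>
    ε (π (pairFst k)) s - ε (π (pairSnd k)) s with hY
  have hYm : ∀ π, Measurable (Y π) := fun π =>
    measurable_pi_lambda _ fun k => (hm _).sub (hm _)
  set V : Equiv.Perm (Fin n) → (Fin (n / 2) → ℝ) → ι → ℝ := fun π z i =>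
    ∑ k, (∫ z', c * shiftLoss z' (d π k i) ∂ν - c * shiftLoss (z k) (d π k i)) with hV
  have hVm : ∀ π i, Measurable fun z => V π z i := fun π i =>
    Finset.measurable_sum _ fun k _ => measurable_const.sub
      (measurable_const.mul ((measurable_shiftLoss _).comp (measurable_pi_apply k)))
  have hVb : ∀ π z i, V π z i ≤ ∑ k, 2 * (c * |d π k i|) := fun π z i => by
    refine Finset.sum_le_sum fun k _ => ?_
    have h1 : ∀ z, |c * shiftLoss z (d π k i)| ≤ c * |d π k i| := fun z => by
      rw [abs_mul, abs_of_nonneg hc0]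
      exact mul_le_mul_of_nonneg_left (abs_shiftLoss_le _ _) hc0
    have h2 := (le_abs_self _).trans (abs_integral_le_of_abs_le (ν := ν) h1)
    have h3 := (neg_le_abs _).trans (h1 (z k))
    linarith
  have hdecomp : ∀ s i, lam * (expectedLoss ν (X *ᵥ γ i)
        - (rankLoss (X *ᵥ γ i - fun l => ε l s) - rankLoss (-fun l => ε l s)))
      = ∑ π : Equiv.Perm (Fin n), (Nat.factorial n : ℝ)⁻¹ * V π (Y π s) i := fun s i => by
    rw [rankLoss_sub_rankLoss, expectedLoss, ← mul_sub, ← Finset.sum_sub_distrib]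
    simp only [← Finset.sum_sub_distrib]
    rw [uStatistic_eq_average hn fun a b => ∫ z, shiftLoss z ((X *ᵥ γ i) a - (X *ᵥ γ i) b) ∂ν
      - shiftLoss (ε a s - ε b s) ((X *ᵥ γ i) a - (X *ᵥ γ i) b), Finset.mul_sum]
    refine Finset.sum_congr rfl fun π _ => ?_
    rw [mul_left_comm, Finset.mul_sum]
    congr 1
    refine Finset.sum_congr rfl fun k _ => ?_
    simp only [integral_const_mul, hc, hd, hY]
    ring
  have hpt : ∀ s, supExp (fun i => lam * (expectedLoss ν (X *ᵥ γ i)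
        - (rankLoss (X *ᵥ γ i - fun l => ε l s) - rankLoss (-fun l => ε l s))))
      ≤ ∑ π : Equiv.Perm (Fin n), (Nat.factorial n : ℝ)⁻¹ * supExp (V π (Y π s)) := fun s => by
    refine supExp_le fun i => ?_
    rw [hdecomp]
    refine (exp_average_le _ (by positivity) sum_perm_inv_factorial _).trans ?_
    exact Finset.sum_le_sum fun π _ =>
      mul_le_mul_of_nonneg_left (exp_le_supExp _ i) (by positivity)
  have hVint : ∀ π, Integrable (fun s => supExp (V π (Y π s))) P := fun π =>
    integrable_supExp (fun i => (hVm π i).comp (hYm π)) fun s i => hVb π (Y π s) i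
  have hbound : ∀ π, ∫ s, supExp (V π (Y π s)) ∂P
      ≤ 2 * p * Real.exp (8 * M ^ 2 * lam ^ 2 * b ^ 2 / m) := fun π => by
    have e : ∫ s, supExp (V π (Y π s)) ∂P
        = ∫ z, supExp (V π z) ∂(Measure.pi fun _ : Fin (n / 2) => ν) := by
      rw [← map_pairDifference_eq_pi hm hind hν π]
      exact (integral_map (hYm π).aemeasurable
        (measurable_supExp (hVm π)).aestronglyMeasurable).symm
    have key := integral_pi_supExp_le (ν := ν) hp hγ (x π)
      (fun k z i => c * shiftLoss z (d π k i))
      (fun k i => measurable_const.mul (measurable_shiftLoss _))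
      (fun k z i => by
        rw [hxd, abs_mul, abs_mul, abs_mul, abs_two, mul_div_cancel_left₀ _ two_ne_zero]
        exact mul_le_mul_of_nonneg_left (abs_shiftLoss_le _ _) (abs_nonneg _))
      (fun k z i i' => by
        rw [hxd, hxd, ← mul_sub, ← mul_sub, ← mul_sub, abs_mul, abs_mul, abs_mul, abs_two,
          mul_div_cancel_left₀ _ two_ne_zero]
        exact mul_le_mul_of_nonneg_left (abs_shiftLoss_sub_le _ _ _) (abs_nonneg _)) 0
    rw [e]
    simp only [Pi.zero_apply, zero_mul, Finset.sum_const_zero, zero_add, mul_zero, neg_zero,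
      Real.exp_zero] at key
    refine key.trans ?_
    have h1 : ∀ j, (1 + 1 : ℝ) * ∏ k, Real.cosh (M * x π k j)
        ≤ 2 * Real.exp (8 * M ^ 2 * lam ^ 2 * b ^ 2 / m) := fun j => by
      have hB : ∀ k, |M * x π k j| ≤ M * (2 * c * (2 * b)) := fun k => by
        simp only [hx]
        rw [abs_mul, abs_mul, abs_of_nonneg hM, abs_of_nonneg (a := 2 * c) (by positivity)]
        refine mul_le_mul_of_nonneg_left (mul_le_mul_of_nonneg_left ?_ (by positivity)) hM
        exact (abs_sub _ _).trans (by linarith [hX (π (pairFst k)) j, hX (π (pairSnd k)) j])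
      rw [one_add_one_eq_two]
      refine mul_le_mul_of_nonneg_left ((prod_cosh_le hB).trans (Real.exp_le_exp.2 (le_of_eq ?_)))
        zero_le_two
      rw [← hm_def, hc]
      field_simp
      ring
    refine (Finset.sum_le_sum fun j _ => h1 j).trans (le_of_eq ?_)
    rw [Finset.sum_const, Finset.card_univ, Fintype.card_fin, nsmul_eq_mul]
    ring
  have hint : Integrable (fun s => ∑ π : Equiv.Perm (Fin n),
      (Nat.factorial n : ℝ)⁻¹ * supExp (V π (Y π s))) P :=
    integrable_finsetSum _ fun π _ => (hVint π).const_mul _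
  refine (integral_mono_of_nonneg (Filter.Eventually.of_forall fun s => (supExp_pos _).le) hint
    (Filter.Eventually.of_forall hpt)).trans ?_
  rw [integral_finsetSum _ fun π _ => (hVint π).const_mul _]
  simp only [integral_const_mul]
  refine (Finset.sum_le_sum fun π _ => mul_le_mul_of_nonneg_left (hbound π)
    (inv_nonneg.2 hf.le)).trans (le_of_eq ?_)
  rw [← Finset.sum_mul, sum_perm_inv_factorial, one_mul]

/-- Uniform one-sided deviation bound for the rank loss over finitely many directions. -/
lemma measure_deviation_ge_le (hn : 2 ≤ n) (hp : 0 < p) {ε : Fin n → S → ℝ}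
    (hm : ∀ i, Measurable (ε i)) (hind : iIndepFun ε P) {ν : Measure ℝ} [IsProbabilityMeasure ν]
    (hν : ∀ i j, i ≠ j → P.map (fun s => ε i s - ε j s) = ν) {X : Matrix (Fin n) (Fin p) ℝ}
    {b M : ℝ} (hb : 0 < b) (hX : ∀ i j, |X i j| ≤ b) {γ : ι → Fin p → ℝ} (hM : 0 < M)
    (hγ : ∀ i, ∑ j, |γ i j| ≤ M) {t : ℝ} (ht : 0 ≤ t) :
    P.real {s | ∃ i, t ≤ expectedLoss ν (X *ᵥ γ i)
        - (rankLoss (X *ᵥ γ i - fun l => ε l s) - rankLoss (-fun l => ε l s))}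
      ≤ 2 * p * Real.exp (-(t ^ 2 * (n / 2 : ℕ) / (32 * M ^ 2 * b ^ 2))) := by
  have hmpos : (0 : ℝ) < (n / 2 : ℕ) := by
    have : 0 < n / 2 := by omega
    exact_mod_cast this
  set m : ℝ := ((n / 2 : ℕ) : ℝ) with hm_def
  -- The minimizer of `8M²lam²b²/m - lam t`.
  set lam : ℝ := t * m / (16 * M ^ 2 * b ^ 2) with hlam
  have hlam0 : 0 ≤ lam := by positivity
  have h1 := integral_supExp_deviation_le (P := P) hn hp hm hind hν hX hM.le hγ hlam0
  rw [← hm_def] at h1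
  set W : S → ι → ℝ := fun s i => lam * (expectedLoss ν (X *ᵥ γ i)
        - (rankLoss (X *ᵥ γ i - fun l => ε l s) - rankLoss (-fun l => ε l s))) with hW
  have hεm : Measurable fun s l => ε l s := measurable_pi_lambda _ hm
  have hWm : ∀ i, Measurable fun s => W s i := fun i => by
    refine measurable_const.mul (measurable_const.sub (Measurable.sub ?_ ?_))
    · exact continuous_rankLoss.measurable.comp (measurable_const.sub hεm)
    · exact continuous_rankLoss.measurable.comp hεm.neg
  have hWint : Integrable (fun s => supExp (W s)) P := by
    refine integrable_supExp (C := fun i => lam * (expectedLoss ν (X *ᵥ γ i)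
      + 1 / ((n : ℝ) * ((n : ℝ) - 1)) * ∑ a, ∑ b ∈ Finset.univ.erase a,
        |(X *ᵥ γ i) a - (X *ᵥ γ i) b|)) hWm fun s i => ?_
    refine mul_le_mul_of_nonneg_left ?_ hlam0
    rw [sub_eq_add_neg, rankLoss_sub_rankLoss, ← mul_neg]
    refine add_le_add le_rfl (mul_le_mul_of_nonneg_left ?_ pairWeight_nonneg)
    simp only [← Finset.sum_neg_distrib]
    exact Finset.sum_le_sum fun a _ => Finset.sum_le_sum fun b _ =>
      (neg_le_abs _).trans (abs_shiftLoss_le _ _)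
  have h2 := mul_meas_ge_le_integral_of_nonneg
    (Filter.Eventually.of_forall fun s => (supExp_pos (W s)).le) hWint (Real.exp (lam * t))
  have h3 : P.real {s | ∃ i, t ≤ expectedLoss ν (X *ᵥ γ i)
        - (rankLoss (X *ᵥ γ i - fun l => ε l s) - rankLoss (-fun l => ε l s))}
      ≤ P.real {s | Real.exp (lam * t) ≤ supExp (W s)} := by
    refine measureReal_mono fun s hs => ?_
    obtain ⟨i, hi⟩ := hs
    exact (Real.exp_le_exp.2 (mul_le_mul_of_nonneg_left hi hlam0)).trans (exp_le_supExp (W s) i)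
  have e : Real.exp (-(t ^ 2 * m / (32 * M ^ 2 * b ^ 2)))
      = Real.exp (8 * M ^ 2 * lam ^ 2 * b ^ 2 / m) / Real.exp (lam * t) := by
    rw [← Real.exp_sub]
    congr 1
    rw [hlam]
    field_simp
    ring
  rw [e, ← mul_div_assoc, le_div_iff₀ (Real.exp_pos _)]
  have h4 := mul_le_mul_of_nonneg_left h3 (Real.exp_pos (lam * t)).le
  linarith

end Deviation

/-! ### From finitely many directions to an arbitrary set -/

section UniformLowerBound

variable {S : Type*} [MeasurableSpace S] {P : Measure S} [IsProbabilityMeasure P] {n p : ℕ}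

/-- With high probability the rank loss grows in all the directions of a set, if its expectation
does. -/
lemma exists_uniform_lower_bound (hn : 2 ≤ n) (hp : 0 < p) {ε : Fin n → S → ℝ}
    (hm : ∀ i, Measurable (ε i)) (hind : iIndepFun ε P) {ν : Measure ℝ} [IsProbabilityMeasure ν]
    (hν : ∀ i j, i ≠ j → P.map (fun s => ε i s - ε j s) = ν) {X : Matrix (Fin n) (Fin p) ℝ}
    {b M : ℝ} (hb : 0 < b) (hX : ∀ i j, |X i j| ≤ b) (hM : 0 < M)
    {T : Set (EuclideanSpace ℝ (Fin p))} (hT : ∀ γ ∈ T, ∑ j, |γ j| ≤ M) {κ t δ : ℝ}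
    (hκ : ∀ γ ∈ T, κ ≤ expectedLoss ν (X *ᵥ γ.ofLp)) (ht : 0 ≤ t) (hδ0 : 0 ≤ δ)
    (hδ : 2 * p * Real.exp (-(t ^ 2 * (n / 2 : ℕ) / (32 * M ^ 2 * b ^ 2))) ≤ δ) :
    ∃ A : Set S, MeasurableSet A ∧ P.real Aᶜ ≤ δ ∧ ∀ s ∈ A, ∀ γ ∈ T,
      κ - t ≤ rankLoss (X *ᵥ γ.ofLp - fun l => ε l s) - rankLoss (-fun l => ε l s) := by
  rcases T.eq_empty_or_nonempty with rfl | hne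
  · exact ⟨Set.univ, MeasurableSet.univ, by simpa using hδ0, fun s _ γ hγ => absurd hγ (by simp)⟩
  have : Nonempty T := hne.to_subtype
  -- The finite bound does not depend on the number of directions, so it passes to a dense sequence
  -- along the increasing events `B N`, and then to all of `T` by continuity in `γ`.
  set u : ℕ → T := TopologicalSpace.denseSeq T
  have hεm : Measurable fun s l => ε l s := measurable_pi_lambda _ hm
  set L : S → EuclideanSpace ℝ (Fin p) → ℝ := fun s γ =>
    rankLoss (X *ᵥ γ.ofLp - fun l => ε l s) - rankLoss (-fun l => ε l s) with hL
  have hLm : ∀ γ, Measurable fun s => L s γ := fun γ =>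
    (continuous_rankLoss.measurable.comp (measurable_const.sub hεm)).sub
      (continuous_rankLoss.measurable.comp hεm.neg)
  have hLc : ∀ s, Continuous (L s) := fun s =>
    (continuous_rankLoss.comp ((Continuous.matrix_mulVec continuous_const
      (PiLp.continuous_ofLp 2 _)).sub continuous_const)).sub continuous_const
  set B : ℕ → Set S := fun N => {s | ∃ k : Fin (N + 1), L s (u k) < κ - t} with hB
  refine ⟨{s | ∀ k, κ - t ≤ L s (u k)}, ?_, ?_, ?_⟩
  · have : {s | ∀ k, κ - t ≤ L s (u k)} = ⋂ k, {s | κ - t ≤ L s (u k)} := by ext; simp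
    rw [this]
    exact MeasurableSet.iInter fun k => measurableSet_le measurable_const (hLm _)
  · have hU : {s | ∀ k, κ - t ≤ L s (u k)}ᶜ = ⋃ N, B N := by
      ext s
      simp only [hB, Set.mem_compl_iff, Set.mem_ofPred_eq, Set.mem_iUnion, not_forall, not_le]
      constructor
      · rintro ⟨k, hk⟩
        exact ⟨k, ⟨k, Nat.lt_succ_self k⟩, hk⟩
      · rintro ⟨N, k, hk⟩
        exact ⟨k, hk⟩
    have hmono : Monotone B := by
      rintro N N' h s ⟨k, hk⟩
      exact ⟨⟨k, by have := k.isLt; omega⟩, hk⟩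
    have hBN : ∀ N, P (B N) ≤ ENNReal.ofReal δ := fun N => by
      have h := measure_deviation_ge_le (P := P) hn hp hm hind hν hb hX
        (γ := fun k : Fin (N + 1) => (u k : EuclideanSpace ℝ (Fin p)).ofLp) hM
        (fun k => hT _ (u k).2) ht
      refine (measure_mono (t := {s | ∃ k : Fin (N + 1), t ≤ expectedLoss ν
        (X *ᵥ (u k : EuclideanSpace ℝ (Fin p)).ofLp) - L s (u k)}) ?_).trans ?_
      · rintro s ⟨k, hk⟩
        exact ⟨k, by linarith [hκ _ (u k).2]⟩
      · rw [← ofReal_measureReal]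
        exact ENNReal.ofReal_le_ofReal (h.trans hδ)
    have hle : P (⋃ N, B N) ≤ ENNReal.ofReal δ := by
      rw [hmono.measure_iUnion]
      exact iSup_le hBN
    rw [hU, measureReal_def]
    exact ENNReal.toReal_le_of_le_ofReal hδ0 hle
  · intro s hs γ hγ
    have hcl : IsClosed {γ : T | κ - t ≤ L s γ} :=
      isClosed_le continuous_const ((hLc s).comp continuous_subtype_val)
    exact (TopologicalSpace.denseRange_denseSeq T).induction_on (p := fun γ : T => κ - t ≤ L s γ)
      ⟨γ, hγ⟩ hcl hs

end UniformLowerBound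

/-! ### Estimates on the cone and the deterministic error bound -/

section Cone

variable {n p g : ℕ} {X : Matrix (Fin n) (Fin p) ℝ} {G : Fin g → Finset (Fin p)} {w : Fin g → ℝ}
  {βs γ : EuclideanSpace ℝ (Fin p)} {c₀ b₁ b₂ : ℝ}

lemma two_lt_cBar (hc₀ : 1 < c₀) : 2 < cBar c₀ := by
  have : 1 < (c₀ + 1) / (c₀ - 1) := by
    rw [lt_div_iff₀ (by linarith)]
    linarith
  unfold cBar
  linarith

lemma groupPenalty_le_of_mem_cone (hG : IsGrouping G) (hw : ∀ l, w l = √((G l).card : ℝ))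
    (hc₀ : 1 < c₀)
    (hγ : groupPenalty G w (proj (expandedSupport G βs)ᶜ γ)
      ≤ (cBar c₀ - 1) * groupPenalty G w (proj (expandedSupport G βs) γ)) :
    groupPenalty G w γ ≤ cBar c₀ * √((expandedSupport G βs).card : ℝ) * ‖γ‖ := by
  rw [groupPenalty_eq_add hG βs]
  have h := mul_le_mul_of_nonneg_left (groupPenalty_proj_le hG hw βs γ)
    (by linarith [two_lt_cBar hc₀] : 0 ≤ cBar c₀)
  linarith

lemma sum_mulVec_eq_zero (hX : ∀ j, ∑ i, X i j = 0) (v : Fin p → ℝ) :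
    ∑ i, (X *ᵥ v) i = 0 := by
  simp only [mulVec, dotProduct]
  rw [Finset.sum_comm]
  simp [← Finset.sum_mul, hX]

lemma abs_mulVec_le (hX : ∀ i j, |X i j| ≤ b₁) (v : Fin p → ℝ) (i : Fin n) :
    |(X *ᵥ v) i| ≤ b₁ * ∑ j, |v j| := by
  simp only [mulVec, dotProduct]
  refine (Finset.abs_sum_le_sum_abs _ _).trans ?_
  rw [Finset.mul_sum]
  refine Finset.sum_le_sum fun j _ => ?_
  rw [abs_mul]
  exact mul_le_mul_of_nonneg_right (hX i j) (abs_nonneg _)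

lemma le_sum_mulVec_sq (hn : 0 < n) (hX : DesignCondition X G w βs c₀ b₁ b₂) (hγ0 : γ ≠ 0)
    (hγ : groupPenalty G w (proj (expandedSupport G βs)ᶜ γ)
      ≤ (cBar c₀ - 1) * groupPenalty G w (proj (expandedSupport G βs) γ)) :
    b₂ * (n * ‖γ‖ ^ 2) ≤ ∑ i, (X *ᵥ γ.ofLp) i ^ 2 := by
  have hn' : (0 : ℝ) < n := by exact_mod_cast hn
  have h := hX.restricted_eigenvalue γ hγ0 hγ
  have : 0 < ‖γ‖ := norm_pos_iff.2 hγ0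
  rw [le_div_iff₀ (by positivity), ← mulVec_mulVec, dotProduct_mulVec, vecMul_transpose] at h
  simpa [dotProduct, sq] using h

/-- The constant `17` is chosen because `17² = 289 ≥ 3 · 96`: with `⌊n/2⌋ ≥ n/3` the exponent
reaches `3 log p`, and `2p · p⁻³ ≤ p⁻¹`. -/
lemma two_mul_exp_tail_le (hn : 2 ≤ n) (hp : 2 ≤ p) {b M : ℝ} (hb : 0 < b) (hM : 0 < M) :
    2 * p * Real.exp (-((17 * b * M * √(Real.log p / n)) ^ 2 * (n / 2 : ℕ)
      / (32 * M ^ 2 * b ^ 2))) ≤ (p : ℝ)⁻¹ := by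
  have hn0 : (0 : ℝ) < n := by exact_mod_cast (by omega : 0 < n)
  have hp2 : (2 : ℝ) ≤ p := by exact_mod_cast hp
  have hp0 : (0 : ℝ) < p := by linarith
  have hlog : 0 ≤ Real.log p := Real.log_nonneg (by linarith)
  have h1 : (17 * b * M * √(Real.log p / n)) ^ 2 * (n / 2 : ℕ) / (32 * M ^ 2 * b ^ 2)
      = 289 / 32 * (Real.log p / n) * (n / 2 : ℕ) := by
    rw [mul_pow _ (√(Real.log p / n)), Real.sq_sqrt (by positivity)]
    field_simp
    ring
  have h2 : 289 / 32 * (Real.log p / n) * (n / 3 : ℝ)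
      ≤ 289 / 32 * (Real.log p / n) * (n / 2 : ℕ) :=
    mul_le_mul_of_nonneg_left (third_le_half hn) (by positivity)
  have h3 : 289 / 32 * (Real.log p / n) * (n / 3 : ℝ) = 289 / 96 * Real.log p := by
    field_simp
    ring
  have h4 : Real.exp (-((3 : ℕ) * Real.log p)) = ((p : ℝ) ^ 3)⁻¹ := by
    rw [Real.exp_neg, Real.exp_nat_mul, Real.exp_log hp0]
  rw [h1]
  have h5 : Real.exp (-(289 / 32 * (Real.log p / n) * (n / 2 : ℕ))) ≤ ((p : ℝ) ^ 3)⁻¹ := by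
    rw [← h4]
    refine Real.exp_le_exp.2 ?_
    push_cast
    linarith
  calc 2 * p * Real.exp (-(289 / 32 * (Real.log p / n) * (n / 2 : ℕ)))
      ≤ 2 * p * ((p : ℝ) ^ 3)⁻¹ := mul_le_mul_of_nonneg_left h5 (by positivity)
    _ = 2 / p * (p : ℝ)⁻¹ := by field_simp
    _ ≤ 1 * (p : ℝ)⁻¹ := by
        refine mul_le_mul_of_nonneg_right ?_ (by positivity)
        rw [div_le_one hp0]
        exact hp2
    _ = (p : ℝ)⁻¹ := one_mul _

/-- The estimation error bound, given the cone condition and the uniform lower bound for the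
increase of the rank loss on a sphere. -/
lemma norm_sub_le_of_lower_bound {b₃ lam x : ℝ} (hG : IsGrouping G)
    (hw : ∀ l, w l = √((G l).card : ℝ)) (X : Matrix (Fin n) (Fin p) ℝ) (hc₀ : 1 < c₀)
    (hb₁ : 0 < b₁) (hb₂ : 0 < b₂) (hb₃ : 0 < b₃) (hlam : 0 < lam) (hx : 0 < x)
    (hω : 0 < √((expandedSupport G βs).card : ℝ)) (hlam8 : lam ≤ 8 * b₁ * c₀ * x)
    {e : Fin n → ℝ}
    (hcone : ∀ γ, objective X (X *ᵥ βs.ofLp + e) G w lam (βs + γ)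
        ≤ objective X (X *ᵥ βs.ofLp + e) G w lam βs →
      groupPenalty G w (proj (expandedSupport G βs)ᶜ γ)
        ≤ (cBar c₀ - 1) * groupPenalty G w (proj (expandedSupport G βs) γ))
    {r : ℝ} (hr : r = 34 * b₁ * c₀ * cBar c₀ / (b₂ * b₃)
      * (√((expandedSupport G βs).card : ℝ) * x))
    (hlow : ∀ γ : EuclideanSpace ℝ (Fin p), ‖γ‖ = r →
      groupPenalty G w (proj (expandedSupport G βs)ᶜ γ)
        ≤ (cBar c₀ - 1) * groupPenalty G w (proj (expandedSupport G βs) γ) →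
      2 * b₂ * b₃ * r ^ 2
          - 17 * b₁ * (cBar c₀ * √((expandedSupport G βs).card : ℝ) * r) * x
        ≤ rankLoss (X *ᵥ γ.ofLp - e) - rankLoss (-e))
    {β : EuclideanSpace ℝ (Fin p)} (hβ : objective X (X *ᵥ βs.ofLp + e) G w lam β
      ≤ objective X (X *ᵥ βs.ofLp + e) G w lam βs) : ‖β - βs‖ ≤ r := by
  have hw0 : ∀ l, 0 ≤ w l := fun l => by rw [hw]; positivity
  have hcbar := two_lt_cBar hc₀
  set cb : ℝ := cBar c₀
  set ω : ℝ := √((expandedSupport G βs).card : ℝ) with hω_def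
  have hr0 : 0 < r := by rw [hr]; positivity
  by_contra! hlt
  have hnorm : 0 < ‖β - βs‖ := hr0.trans hlt
  -- Shrinks the perturbation to norm exactly `r`; by convexity the objective there still does not
  -- exceed its value at `βs`.
  set τ : ℝ := r / ‖β - βs‖ with hτ
  have hτ0 : 0 ≤ τ := by positivity
  have hτ1 : τ ≤ 1 := (div_le_one hnorm).2 hlt.le
  have hobj : objective X (X *ᵥ βs.ofLp + e) G w lam (βs + τ • (β - βs))
      ≤ objective X (X *ᵥ βs.ofLp + e) G w lam βs := by
    have h1 := objective_segment_le (G := G) hw0 X (X *ᵥ βs.ofLp + e) hlam.le βs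
      (β - βs) hτ0 hτ1
    rw [add_sub_cancel] at h1
    have h2 := mul_le_mul_of_nonneg_left hβ hτ0
    linarith
  set γ := τ • (β - βs) with hγ
  have hγnorm : ‖γ‖ = r := by
    rw [hγ, norm_smul, Real.norm_eq_abs, abs_of_nonneg hτ0, hτ, div_mul_cancel₀ _ hnorm.ne']
  have h1 := hlow γ hγnorm (hcone γ hobj)
  have h2 := objective_add_sub (G := G) (w := w) X e lam βs γ
  have h3 := groupPenalty_sub_le hG hw0 βs γ
  have h4 := groupPenalty_proj_le hG hw βs γ
  have h5 := groupPenalty_nonneg (G := G) hw0 (proj (expandedSupport G βs)ᶜ γ)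
  rw [hγnorm, ← hω_def] at h4
  have h6 : lam * (groupPenalty G w βs - groupPenalty G w (βs + γ)) ≤ lam * (ω * r) :=
    mul_le_mul_of_nonneg_left (by linarith) hlam.le
  have h7 : lam * (ω * r) ≤ 8 * b₁ * c₀ * x * (ω * r) :=
    mul_le_mul_of_nonneg_right hlam8 (by positivity)
  have h8 : 2 * b₂ * b₃ * r ^ 2 ≤ 17 * b₁ * (cb * ω * r) * x + 8 * b₁ * c₀ * x * (ω * r) := by
    linarith
  have h9 : 2 * b₂ * b₃ * r ^ 2 = (b₁ * ω * x * r) * (68 * (c₀ * cb)) := by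
    rw [sq]
    nth_rewrite 1 [hr]
    field_simp
    ring
  have h10 : 17 * b₁ * (cb * ω * r) * x + 8 * b₁ * c₀ * x * (ω * r)
      = (b₁ * ω * x * r) * (17 * cb + 8 * c₀) := by ring
  rw [h9, h10] at h8
  have h11 := le_of_mul_le_mul_left h8 (by positivity)
  -- `68 c₀ c̄ ≤ 17 c̄ + 8 c₀` is impossible for `c₀ > 1` and `c̄ > 2`.
  nlinarith [mul_pos (sub_pos.2 hc₀) (sub_pos.2 hcbar)]

end Cone

end RankGroupLasso

/-! ### The main theorem -/

open RankGroupLasso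

theorem corollary1 {S : Type*} [MeasurableSpace S] (P : Measure S) [IsProbabilityMeasure P]
    {n p g : ℕ} (X : Matrix (Fin n) (Fin p) ℝ) (βs : EuclideanSpace ℝ (Fin p))
    (ε : Fin n → S → ℝ)
    (G : Fin g → Finset (Fin p)) (hG : RankGroupLasso.IsGrouping G)
    (w : Fin g → ℝ) (hw : ∀ l, w l = √((G l).card : ℝ))
    (c₀ α₀ b₁ b₂ b₃ : ℝ) (hc₀ : 1 < c₀) (hα₀ : 0 < α₀) (hα₀' : α₀ < 1)
    (hb₁ : 0 < b₁) (hb₂ : 0 < b₂) (hb₃ : 0 < b₃)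
    (hX : RankGroupLasso.DesignCondition X G w βs c₀ b₁ b₂)
    (hε : RankGroupLasso.ErrorCondition P ε b₃
      (68 * b₁ ^ 2 * c₀ * RankGroupLasso.cBar c₀ ^ 2 / (b₂ * b₃)
        * RankGroupLasso.cMax G w ^ 2 * RankGroupLasso.cSupport G w βs ^ 2
        * RankGroupLasso.rate n p))
    (hp : 2 / α₀ ≤ (p : ℝ)) (hpn : (p : ℝ) ≤ Real.exp n)
    (hlam : 0 < RankGroupLasso.lambdaStar X G w c₀ α₀) :
    (∀ s, ∃ β, RankGroupLasso.IsEstimator X (X *ᵥ βs.ofLp + fun i => ε i s) G w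
      (RankGroupLasso.lambdaStar X G w c₀ α₀) β) ∧
    ∃ A : Set S, MeasurableSet A ∧ 1 - (p : ℝ)⁻¹ - α₀ ≤ P.real A ∧
      ∀ s ∈ A, ∀ β, RankGroupLasso.IsEstimator X (X *ᵥ βs.ofLp + fun i => ε i s) G w
          (RankGroupLasso.lambdaStar X G w c₀ α₀) β →
        ‖β - βs‖ ≤ 68 * b₁ * c₀ * RankGroupLasso.cBar c₀ / (b₂ * b₃)
          * √(((RankGroupLasso.expandedSupport G βs).card : ℝ) * Real.log p / n) := by
  refine ⟨fun s => exists_isEstimator hG hw X _ hlam, ?_⟩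
  have hw0 : ∀ l, 0 ≤ w l := fun l => by rw [hw]; positivity
  have hp2 : (2 : ℝ) < p := by
    refine lt_of_lt_of_le ?_ hp
    rw [lt_div_iff₀ hα₀]
    linarith
  have hp3 : 3 ≤ p := by exact_mod_cast hp2
  have hp0 : (0 : ℝ) < p := by linarith
  -- If `n ≤ 1`, then `p ≤ eⁿ ≤ e < 3`.
  have hn : 2 ≤ n := by
    by_contra! h
    have h1 : (n : ℝ) ≤ 1 := by exact_mod_cast (by omega : n ≤ 1)
    have h2 : (3 : ℝ) ≤ p := by exact_mod_cast hp3
    have h3 := Real.exp_le_exp.2 h1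
    linarith [Real.exp_one_lt_d9]
  have hn0 : (0 : ℝ) < n := by exact_mod_cast (by omega : 0 < n)
  have hlog : 0 < Real.log p := Real.log_pos (by linarith)
  set x : ℝ := √(Real.log p / n) with hx
  have hx0 : 0 < x := Real.sqrt_pos.2 (by positivity)
  have hxsq : x ^ 2 = Real.log p / n := Real.sq_sqrt (by positivity)
  have hcbar := two_lt_cBar hc₀
  set cb : ℝ := cBar c₀ with hcb
  set lam : ℝ := lambdaStar X G w c₀ α₀ with hlam_def
  set q : ℝ := sInf {t : ℝ | 1 - α₀ ≤ dualGradientCDF X G w t} with hq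
  have hlamq : lam = c₀ * q := rfl
  have hcdf := le_dualGradientCDF hG hw hn (by omega : 2 ≤ p) hb₁ hX.bounded hα₀ hp
  have hqle : q ≤ 8 * b₁ * x :=
    csInf_le (dualGradientCDF_set_bddBelow hG hw (by linarith)) hcdf
  set K := dualSublevel X G w q with hK
  have hf : (0 : ℝ) < (Nat.factorial n : ℝ) := by exact_mod_cast Nat.factorial_pos n
  obtain ⟨f, hdens⟩ := hε.density
  obtain ⟨fs, hdiff, hfs⟩ := hε.difference_density
  set A₁ : Set S := {s | (fun i => ε i s) ∈ compatibleErrors K} with hA₁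
  have hA₁m : MeasurableSet A₁ :=
    (measurable_pi_lambda _ hε.measurable) (measurableSet_compatibleErrors K)
  have hA₁P : 1 - α₀ ≤ P.real A₁ := by
    have h1 := card_le_measure_compatibleErrors hε.measurable hε.indep
      (fun i => (hdens i).law) K
    have h2 := le_dualGradientCDF_sInf hcdf
    rw [dualGradientCDF_eq, le_div_iff₀ hf] at h2
    refine le_of_mul_le_mul_right (h2.trans ?_) hf
    rw [mul_comm]
    exact h1
  have hcone : ∀ s ∈ A₁, ∀ γ, objective X (X *ᵥ βs.ofLp + fun i => ε i s) G w lam (βs + γ)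
        ≤ objective X (X *ᵥ βs.ofLp + fun i => ε i s) G w lam βs →
      groupPenalty G w (proj (expandedSupport G βs)ᶜ γ)
        ≤ (cb - 1) * groupPenalty G w (proj (expandedSupport G βs) γ) := by
    rintro s ⟨r, hrK, hr⟩ γ hobj
    refine mem_cone hG hw X hr hc₀ hlam ?_ hobj
    rw [hlamq]
    have : dualPenalty G w (rankGradient X r) ≤ q := by
      simpa [hK, dualSublevel] using hrK
    exact mul_le_mul_of_nonneg_left this (by linarith)
  set ω : ℝ := √((expandedSupport G βs).card : ℝ) with hω
  have hωsq : ω ^ 2 = (expandedSupport G βs).card := Real.sq_sqrt (by positivity)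
  have hgoal : √(((expandedSupport G βs).card : ℝ) * Real.log p / n) = ω * x := by
    rw [mul_div_assoc, Real.sqrt_mul (by positivity)]
  rw [hgoal]
  -- If `Ω` is empty there is no sphere of positive radius to work on, but the cone condition alone
  -- forces `Ψ(β - βs) = 0`.
  rcases (Real.sqrt_nonneg ((expandedSupport G βs).card : ℝ)).eq_or_lt with hω0 | hω0
  · rw [← hω] at hω0
    refine ⟨A₁, hA₁m, by linarith [inv_pos.2 hp0], fun s hs β hβ => ?_⟩
    have h1 := hcone s hs (β - βs) (by rw [add_sub_cancel]; exact hβ (Set.mem_univ βs))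
    have h2 := groupPenalty_le_of_mem_cone hG hw hc₀ h1
    rw [← hω, ← hω0, mul_zero, zero_mul] at h2
    rw [← hω0, zero_mul, mul_zero]
    exact (norm_le_groupPenalty hG hw _).trans h2
  rw [← hω] at hω0
  -- Half of the claimed bound. With this choice the differences of `X γ` are at most `2 b₁ M`,
  -- which is the radius in (A-2) with `x` in place of the larger `rate n p`.
  set r : ℝ := 34 * b₁ * c₀ * cb / (b₂ * b₃) * (ω * x) with hr
  have hr0 : 0 < r := by positivity
  set M : ℝ := cb * ω * r with hM
  have hM0 : 0 < M := by positivity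
  set T : Set (EuclideanSpace ℝ (Fin p)) := {γ | ‖γ‖ = r ∧
    groupPenalty G w (proj (expandedSupport G βs)ᶜ γ)
      ≤ (cb - 1) * groupPenalty G w (proj (expandedSupport G βs) γ)} with hT
  have hTl1 : ∀ γ ∈ T, ∑ j, |γ j| ≤ M := fun γ hγ => by
    have := groupPenalty_le_of_mem_cone hG hw hc₀ hγ.2
    rw [hγ.1] at this
    exact (l1_le_groupPenalty hG hw γ).trans this
  have hradius : 2 * (b₁ * M) ≤ 68 * b₁ ^ 2 * c₀ * cb ^ 2 / (b₂ * b₃)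
        * cMax G w ^ 2 * cSupport G w βs ^ 2 * rate n p := by
    have hrate : x ≤ rate n p := by
      have h1 : x = √((n : ℝ)⁻¹ * Real.log p) := by rw [hx, div_eq_inv_mul]
      rw [rate, h1]
      have : 0 ≤ (n : ℝ)⁻¹ * Real.log p := by positivity
      linarith
    rw [cMax_eq_one hG hw (by omega), cSupport_sq hG hw, ← hωsq, one_pow, mul_one]
    calc 2 * (b₁ * M) = 68 * b₁ ^ 2 * c₀ * cb ^ 2 / (b₂ * b₃) * ω ^ 2 * x := by
          rw [hM, hr]; ring
      _ ≤ _ := mul_le_mul_of_nonneg_left hrate (by positivity)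
  obtain ⟨i₀, i₁, hi⟩ : ∃ i j : Fin n, i ≠ j :=
    ⟨⟨0, by omega⟩, ⟨1, by omega⟩, by simp⟩
  set ν : Measure ℝ := volume.withDensity fun z => ENNReal.ofReal (fs z) with hν
  have hνlaw : ∀ i j, i ≠ j → P.map (fun s => ε i s - ε j s) = ν := fun i j h => (hdiff i j h).law
  have hdm : ∀ i j, Measurable fun s => ε i s - ε j s := fun i j =>
    (hε.measurable i).sub (hε.measurable j)
  have hνprob : IsProbabilityMeasure ν := by
    rw [← hνlaw i₀ i₁ hi]
    exact Measure.isProbabilityMeasure_map (hdm _ _).aemeasurable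
  have hsymm : ν.map (fun z => -z) = ν := by
    conv_lhs => rw [← hνlaw i₀ i₁ hi]
    rw [Measure.map_map measurable_neg (hdm _ _), ← hνlaw i₁ i₀ hi.symm]
    congr 1
    ext s
    simp
  have hκ : ∀ γ ∈ T, 2 * b₂ * b₃ * r ^ 2 ≤ expectedLoss ν (X *ᵥ γ.ofLp) := fun γ hγ => by
    have hγ0 : γ ≠ 0 := norm_pos_iff.1 (hγ.1 ▸ hr0)
    have h1 := le_sum_mulVec_sq (by omega) hX hγ0 hγ.2
    have h2 : ∀ i, |(X *ᵥ γ.ofLp) i| ≤ b₁ * M := fun i =>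
      (abs_mulVec_le hX.bounded _ i).trans (mul_le_mul_of_nonneg_left (hTl1 γ hγ) hb₁.le)
    refine le_trans ?_ (le_expectedLoss hn hb₃.le
      (fun d hd => le_integral_shiftLoss hsymm hb₃ hν hfs hd)
      (sum_mulVec_eq_zero hX.centered _) fun i j => (abs_sub _ _).trans ?_)
    · rw [hγ.1] at h1
      refine le_trans (le_of_eq ?_) (mul_le_mul_of_nonneg_left h1 (by positivity))
      field_simp
    · linarith [h2 i, h2 j]
  have hδ := two_mul_exp_tail_le hn (by omega : 2 ≤ p) hb₁ hM0
  rw [← hx] at hδ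
  obtain ⟨A₂, hA₂m, hA₂P, hA₂⟩ := exists_uniform_lower_bound (P := P) hn (by omega) hε.measurable
    hε.indep hνlaw hb₁ hX.bounded hM0 hTl1 hκ (by positivity) (by positivity) hδ
  refine ⟨A₁ ∩ A₂, hA₁m.inter hA₂m, ?_, ?_⟩
  · have h1 : P.real (A₁ ∩ A₂)ᶜ ≤ P.real A₁ᶜ + P.real A₂ᶜ := by
      rw [Set.compl_inter]
      exact measureReal_union_le _ _
    rw [probReal_compl_eq_one_sub (hA₁m.inter hA₂m), probReal_compl_eq_one_sub hA₁m] at h1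
    linarith
  rintro s ⟨hs₁, hs₂⟩ β hβ
  have hlam8 : lam ≤ 8 * b₁ * c₀ * x := by
    rw [hlamq]
    linarith [mul_le_mul_of_nonneg_left hqle (by linarith : 0 ≤ c₀)]
  have h := norm_sub_le_of_lower_bound hG hw X hc₀ hb₁ hb₂ hb₃ hlam hx0 hω0 hlam8 (hcone s hs₁) hr
    (fun γ hγ hγ' => hA₂ s hs₂ γ ⟨hγ, hγ'⟩) (hβ (Set.mem_univ βs))
  refine h.trans (mul_le_mul_of_nonneg_right ?_ (by positivity))
  refine div_le_div_of_nonneg_right ?_ (by positivity)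
  have : 0 ≤ b₁ * c₀ * cb := by positivity
  linarith
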